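/- Let $d\ge 1$, let $\Omega\subset\mathbb R^d$ be a bounded open set (for instance a bounded Lipschitz domain) and $T>0$. Write $\langle\cdot,\cdot\rangle$, $\|\cdot\|$ for the inner product and norm of $L^2(\Omega)$ or $L^2(\Omega)^d$, and let $H(\mathrm{div};\Omega)$ be the space of $\mathbf v\in L^2(\Omega)^d$ with distributional divergence $\nabla\cdot\mathbf v\in L^2(\Omega)$, with its usual norm. Let $s,a,f_w,f_2:\mathbb R\to\mathbb R$ and $\mathbf f_1,\mathbf f_3:\mathbb R\to\mathbb R^d$ be Lipschitz continuous, where $s$ is nondecreasing with values in $[0,1]$, $0<a_\star\le a\le a^\star<\infty$ for some constants $a_\star,a^\star$, and $f_w$ is bounded. Let $\Theta_I\in L^2(\Omega)$ and $M_{\mathbf u}\in\mathbb R$. A solution of Problem $P$ consists of $\Theta,p\in L^2(0,T;L^2(\Omega))$, $\mathbf q\in L^2(0,T;L^2(\Omega)^d)$, $\mathbf u\in L^2(0,T;H(\mathrm{div};\Omega))$ with $s(\Theta)\in L^\infty(\Omega\times(0,T))$, $t\mapsto\int_0^t\mathbf q\,dy\in C([0,T];H(\mathrm{div};\Omega))$,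 $\Theta(0)=\Theta_I$, and for all $t\in(0,T]$, $w\in L^2(\Omega)$, $\mathbf v\in H(\mathrm{div};\Omega)$ $$\langle s(\Theta(t))-s(\Theta_I),w\rangle+\Big\langle\nabla\cdot\int_0^t\mathbf q\,dy,w\Big\rangle=0,$$ $$\Big\langle\int_0^t\mathbf q\,dy,\mathbf v\Big\rangle-\Big\langle\int_0^t\Theta\,dy,\nabla\cdot\mathbf v\Big\rangle-\Big\langle\int_0^t f_w(s(\Theta))\mathbf u\,dy,\mathbf v\Big\rangle=\Big\langle\int_0^t\mathbf f_1(s(\Theta))\,dy,\mathbf v\Big\rangle,$$ $$\langle\nabla\cdot\mathbf u(t),w\rangle=\langle f_2(s(\Theta(t))),w\rangle,$$ $$\langle a(s(\Theta(t)))\mathbf u(t),\mathbf v\rangle-\langle p(t),\nabla\cdot\mathbf v\rangle+\langle\mathbf f_3(s(\Theta(t))),\mathbf v\rangle=0.$$ For an integer $N\ge1$ let $\tau=T/N$, $t_n=n\tau$, and $\bar g^n=\frac1\tau\int_{t_{n-1}}^{t_n}g(t)\,dt$. A semi-discrete solution consists of $\Theta^0=\Theta_I$ and, for $n=1,\dots,N$,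 $\Theta^n,p^n\in L^2(\Omega)$ and $\mathbf q^n,\mathbf u^n\in H(\mathrm{div};\Omega)$ such that for all $w\in L^2(\Omega)$, $\mathbf v\in H(\mathrm{div};\Omega)$ $$\langle s(\Theta^n)-s(\Theta^{n-1}),w\rangle+\tau\langle\nabla\cdot\mathbf q^n,w\rangle=0,$$ $$\langle\mathbf q^n,\mathbf v\rangle-\langle\Theta^n,\nabla\cdot\mathbf v\rangle-\langle f_w(s(\Theta^n))\mathbf u^n,\mathbf v\rangle=\langle\mathbf f_1(s(\Theta^n)),\mathbf v\rangle,$$ $$\langle\nabla\cdot\mathbf u^n,w\rangle=\langle f_2(s(\Theta^n)),w\rangle,$$ $$\langle a(s(\Theta^n))\mathbf u^n,\mathbf v\rangle-\langle p^n,\nabla\cdot\mathbf v\rangle+\langle\mathbf f_3(s(\Theta^n)),\mathbf v\rangle=0.$$ Then there are constants $C>0$ and $\tau_0>0$, depending only on the data $d,\Omega,T,s,a,f_w,\mathbf f_1,f_2,\mathbf f_3,\Theta_I,M_{\mathbf u}$, such that for every solution $(\Theta,\mathbf q,p,\mathbf u)$ of Problem $P$ with $|\mathbf u|\le M_{\mathbf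 u}$ almost everywhere in $\Omega\times(0,T)$, every $N\ge1$ with $\tau=T/N\le\tau_0$, and every semi-discrete solution $(\Theta^n,\mathbf q^n,p^n,\mathbf u^n)_{1\le n\le N}$, $$\sum_{n=1}^N\int_{t_{n-1}}^{t_n}\langle s(\Theta(t))-s(\Theta^n),\Theta(t)-\Theta^n\rangle\,dt+\Big\|\sum_{n=1}^N\int_{t_{n-1}}^{t_n}(\mathbf q-\mathbf q^n)\,dt\Big\|^2+\sum_{n=1}^N\Big\|\int_{t_{n-1}}^{t_n}(\mathbf q-\mathbf q^n)\,dt\Big\|^2\le C\tau,$$ $$\tau\|\bar{\mathbf u}^n-\mathbf u^n\|^2+\tau\|\bar p^n-p^n\|^2\le C\int_{t_{n-1}}^{t_n}\|s(\Theta(t))-s(\Theta^n)\|^2\,dt\qquad(n=1,\dots,N),$$ $$\Big\|\sum_{n=1}^N\int_{t_{n-1}}^{t_n}(\Theta(t)-\Theta^n)\,dt\Big\|^2\le C\tau.$$ -/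

import Mathlib

open MeasureTheory Set
open scoped ContDiff InnerProductSpace

noncomputable section

namespace TwoPhase

/-- The Euclidean space `ℝ^d`. -/
abbrev Space (d : ℕ) : Type := EuclideanSpace ℝ (Fin d)

/-- `L²(Ω)`. -/
abbrev L2 {d : ℕ} (Ω : Set (Space d)) : Type :=
  Lp ℝ 2 ((volume : Measure (Space d)).restrict Ω)

/-- `L²(Ω)^d`. -/
abbrev L2vec {d : ℕ} (Ω : Set (Space d)) : Type :=
  Lp (Space d) 2 ((volume : Measure (Space d)).restrict Ω)

/-- `g` is the distributional divergence of `v` on `Ω`. -/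
def IsWeakDiv {d : ℕ} (Ω : Set (Space d)) (v : L2vec Ω) (g : L2 Ω) : Prop :=
  ∀ φ : Space d → ℝ, ContDiff ℝ ∞ φ → HasCompactSupport φ → tsupport φ ⊆ Ω →
    ∫ x in Ω, ⟪v x, gradient φ x⟫_ℝ = - ∫ x in Ω, g x * φ x

theorem gradient_memLp {d : ℕ} (Ω : Set (Space d)) {φ : Space d → ℝ} (h : ContDiff ℝ ∞ φ)
    (hc : HasCompactSupport φ) :
    MemLp (gradient φ) 2 ((volume : Measure (Space d)).restrict Ω) := by
  have hcont : Continuous (gradient φ) :=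
    (InnerProductSpace.toDual ℝ (Space d)).symm.continuous.comp (h.continuous_fderiv (by simp))
  have hsupp : HasCompactSupport (gradient φ) :=
    (hc.fderiv (𝕜 := ℝ)).comp_left (g := (InnerProductSpace.toDual ℝ (Space d)).symm) (by simp)
  exact (hcont.memLp_of_hasCompactSupport hsupp).restrict Ω

theorem testFun_memLp {d : ℕ} (Ω : Set (Space d)) {φ : Space d → ℝ} (h : ContDiff ℝ ∞ φ)
    (hc : HasCompactSupport φ) :
    MemLp φ 2 ((volume : Measure (Space d)).restrict Ω) :=
  (h.continuous.memLp_of_hasCompactSupport hc).restrict Ω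

theorem integral_inner_gradient {d : ℕ} (Ω : Set (Space d)) {φ : Space d → ℝ}
    (h : ContDiff ℝ ∞ φ) (hc : HasCompactSupport φ) (v : L2vec Ω) :
    ∫ x in Ω, ⟪v x, gradient φ x⟫_ℝ = ⟪v, (gradient_memLp Ω h hc).toLp _⟫_ℝ := by
  rw [L2.inner_def]
  refine integral_congr_ae ?_
  filter_upwards [(gradient_memLp Ω h hc).coeFn_toLp] with x hx
  rw [hx]

theorem integral_mul_testFun {d : ℕ} (Ω : Set (Space d)) {φ : Space d → ℝ}
    (h : ContDiff ℝ ∞ φ) (hc : HasCompactSupport φ) (g : L2 Ω) :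
    ∫ x in Ω, g x * φ x = ⟪g, (testFun_memLp Ω h hc).toLp _⟫_ℝ := by
  rw [L2.inner_def]
  refine integral_congr_ae ?_
  filter_upwards [(testFun_memLp Ω h hc).coeFn_toLp] with x hx
  rw [hx]
  simp [mul_comm]

/-- The graph of the distributional divergence in `L²(Ω)^d × L²(Ω)`. -/
def divGraph {d : ℕ} (Ω : Set (Space d)) : Submodule ℝ (WithLp 2 (L2vec Ω × L2 Ω)) where
  carrier := {z | IsWeakDiv Ω z.fst z.snd}
  add_mem' := by
    intro y z hy hz φ h hc hs
    have h1 := hy φ h hc hs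
    have h2 := hz φ h hc hs
    rw [integral_inner_gradient Ω h hc, integral_mul_testFun Ω h hc] at *
    rw [WithLp.add_fst, WithLp.add_snd, inner_add_left, inner_add_left, h1, h2]
    ring
  zero_mem' := by
    intro φ h hc hs
    rw [integral_inner_gradient Ω h hc, integral_mul_testFun Ω h hc]
    simp
  smul_mem' := by
    intro c z hz φ h hc hs
    have h1 := hz φ h hc hs
    rw [integral_inner_gradient Ω h hc, integral_mul_testFun Ω h hc] at *
    rw [WithLp.smul_fst, WithLp.smul_snd, real_inner_smul_left, real_inner_smul_left, h1]
    ring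

/-- `H(div; Ω)`, realized as the space of pairs `(v, ∇·v)` with `v ∈ L²(Ω)^d` and distributional
divergence `∇·v ∈ L²(Ω)`. The norm inherited from the Hilbert product is the usual
`‖v‖_div = (‖v‖² + ‖∇·v‖²)^{1/2}`. -/
abbrev Hdiv {d : ℕ} (Ω : Set (Space d)) : Type := divGraph Ω

/-- The `L²` vector field underlying an element of `H(div; Ω)`. -/
def Hdiv.field {d : ℕ} {Ω : Set (Space d)} (v : Hdiv Ω) : L2vec Ω := v.1.fst

/-- The divergence of an element of `H(div; Ω)`. -/
def Hdiv.div {d : ℕ} {Ω : Set (Space d)} (v : Hdiv Ω) : L2 Ω := v.1.snd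

open Classical in
/-- The `L²(Ω)` class of a square integrable function (`0` for any other function). It is only
applied to functions which are square integrable under the standing assumptions, see
`Coeffs.Admissible.memLp_comp` and `Coeffs.Admissible.memLp_smul`. -/
def toL2 {d : ℕ} {F : Type*} [NormedAddCommGroup F] (Ω : Set (Space d)) (g : Space d → F) :
    Lp F 2 ((volume : Measure (Space d)).restrict Ω) :=
  if h : MemLp g 2 ((volume : Measure (Space d)).restrict Ω) then h.toLp g else 0

/-- The coefficient functions of the two-phase flow model. -/
structure Coeffs (d : ℕ) where
  s : ℝ → ℝ
  a : ℝ → ℝ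
  fw : ℝ → ℝ
  f1 : ℝ → Space d
  f2 : ℝ → ℝ
  f3 : ℝ → Space d

/-- The assumptions on the coefficient functions. -/
structure Coeffs.Admissible {d : ℕ} (c : Coeffs d) : Prop where
  s_mem : ∀ y, c.s y ∈ Icc (0 : ℝ) 1
  s_mono : Monotone c.s
  s_lip : ∃ K, LipschitzWith K c.s
  a_lip : ∃ K, LipschitzWith K c.a
  a_bounds : ∃ aLow aUp : ℝ, 0 < aLow ∧ ∀ y, aLow ≤ c.a y ∧ c.a y ≤ aUp
  f1_lip : ∃ K, LipschitzWith K c.f1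
  f2_lip : ∃ K, LipschitzWith K c.f2
  f3_lip : ∃ K, LipschitzWith K c.f3
  fw_lip : ∃ K, LipschitzWith K c.fw
  fw_bdd : ∃ M, ∀ y, |c.fw y| ≤ M

/-- `s(θ)`. -/
def Coeffs.sat {d : ℕ} (c : Coeffs d) {Ω : Set (Space d)} (θ : L2 Ω) : L2 Ω :=
  toL2 Ω fun x => c.s (θ x)

/-- `a(s(θ)) v`. -/
def Coeffs.aMul {d : ℕ} (c : Coeffs d) {Ω : Set (Space d)} (θ : L2 Ω) (v : L2vec Ω) : L2vec Ω :=
  toL2 Ω fun x => c.a (c.s (θ x)) • v x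

/-- `f_w(s(θ)) v`. -/
def Coeffs.fwMul {d : ℕ} (c : Coeffs d) {Ω : Set (Space d)} (θ : L2 Ω) (v : L2vec Ω) : L2vec Ω :=
  toL2 Ω fun x => c.fw (c.s (θ x)) • v x

/-- `f₁(s(θ))`. -/
def Coeffs.f1Sat {d : ℕ} (c : Coeffs d) {Ω : Set (Space d)} (θ : L2 Ω) : L2vec Ω :=
  toL2 Ω fun x => c.f1 (c.s (θ x))

/-- `f₂(s(θ))`. -/
def Coeffs.f2Sat {d : ℕ} (c : Coeffs d) {Ω : Set (Space d)} (θ : L2 Ω) : L2 Ω :=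
  toL2 Ω fun x => c.f2 (c.s (θ x))

/-- `f₃(s(θ))`. -/
def Coeffs.f3Sat {d : ℕ} (c : Coeffs d) {Ω : Set (Space d)} (θ : L2 Ω) : L2vec Ω :=
  toL2 Ω fun x => c.f3 (c.s (θ x))

/-- On a bounded set, the superposition of a continuous function with the saturation is
square integrable. With `g = id` this covers `s(θ)` itself. -/
theorem Coeffs.Admissible.memLp_comp {d : ℕ} {c : Coeffs d} (hc : c.Admissible)
    {Ω : Set (Space d)} (hΩ : Bornology.IsBounded Ω) {F : Type*} [NormedAddCommGroup F]
    {g : ℝ → F} (hg : Continuous g) (θ : L2 Ω) :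
    MemLp (fun x => g (c.s (θ x))) 2 ((volume : Measure (Space d)).restrict Ω) := by
  obtain ⟨K, hK⟩ := hc.s_lip
  obtain ⟨M, hM⟩ := (isCompact_Icc (a := (0 : ℝ)) (b := 1)).exists_bound_of_continuousOn
    hg.continuousOn
  have : IsFiniteMeasure ((volume : Measure (Space d)).restrict Ω) :=
    ⟨by simpa using hΩ.measure_lt_top⟩
  exact MemLp.of_bound
    ((hg.comp hK.continuous).comp_aestronglyMeasurable (Lp.aestronglyMeasurable θ)) M
    (Filter.Eventually.of_forall fun x => hM _ (hc.s_mem _))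

theorem Coeffs.Admissible.memLp_smul {d : ℕ} {c : Coeffs d} (hc : c.Admissible)
    {Ω : Set (Space d)} {g : ℝ → ℝ} (hg : Continuous g) (θ : L2 Ω) (v : L2vec Ω) :
    MemLp (fun x => g (c.s (θ x)) • v x) 2 ((volume : Measure (Space d)).restrict Ω) := by
  obtain ⟨K, hK⟩ := hc.s_lip
  obtain ⟨M, hM⟩ := (isCompact_Icc (a := (0 : ℝ)) (b := 1)).exists_bound_of_continuousOn
    hg.continuousOn
  refine (Lp.memLp v).of_le_mul (c := M) ?_ ?_
  · exact ((hg.comp hK.continuous).comp_aestronglyMeasurable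
      (Lp.aestronglyMeasurable θ)).smul (Lp.aestronglyMeasurable v)
  · refine Filter.Eventually.of_forall fun x => ?_
    rw [norm_smul]
    exact mul_le_mul_of_nonneg_right (hM _ (hc.s_mem _)) (norm_nonneg _)

/-- `g ∈ L²(0, T; X)`. -/
def MemL2Time {X : Type*} [NormedAddCommGroup X] (T : ℝ) (g : ℝ → X) : Prop :=
  MemLp g 2 ((volume : Measure ℝ).restrict (Ioo 0 T))

/-- The continuous mixed variational problem: `(Θ, q, p, u)` is a solution with initial value
`ΘI`. The function `Q` is `t ↦ ∫₀ᵗ q`, as a continuous function with values in `H(div; Ω)`. -/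
structure IsContinuousSolution {d : ℕ} (c : Coeffs d) (Ω : Set (Space d)) (T : ℝ) (ΘI : L2 Ω)
    (Θ : ℝ → L2 Ω) (q : ℝ → L2vec Ω) (p : ℝ → L2 Ω) (u : ℝ → Hdiv Ω) : Prop where
  Θ_mem : MemL2Time T Θ
  q_mem : MemL2Time T q
  p_mem : MemL2Time T p
  u_mem : MemL2Time T u
  sat_bdd : ∃ M : ℝ, ∀ᵐ t ∂((volume : Measure ℝ).restrict (Ioo 0 T)),
    ∀ᵐ x ∂((volume : Measure (Space d)).restrict Ω), |c.s (Θ t x)| ≤ M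
  init : Θ 0 = ΘI
  mass : ∃ Q : ℝ → Hdiv Ω, ContinuousOn Q (Icc 0 T) ∧
    (∀ t ∈ Icc 0 T, (Q t).field = ∫ y in (0 : ℝ)..t, q y) ∧
    ∀ t ∈ Ioc 0 T, ∀ w : L2 Ω,
      ⟪c.sat (Θ t) - c.sat ΘI, w⟫_ℝ + ⟪(Q t).div, w⟫_ℝ = 0
  flux : ∀ t ∈ Ioc 0 T, ∀ v : Hdiv Ω,
    ⟪∫ y in (0 : ℝ)..t, q y, v.field⟫_ℝ - ⟪∫ y in (0 : ℝ)..t, Θ y, v.div⟫_ℝ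
        - ⟪∫ y in (0 : ℝ)..t, c.fwMul (Θ y) (u y).field, v.field⟫_ℝ
      = ⟪∫ y in (0 : ℝ)..t, c.f1Sat (Θ y), v.field⟫_ℝ
  totalMass : ∀ t ∈ Ioc 0 T, ∀ w : L2 Ω, ⟪(u t).div, w⟫_ℝ = ⟪c.f2Sat (Θ t), w⟫_ℝ
  darcy : ∀ t ∈ Ioc 0 T, ∀ v : Hdiv Ω,
    ⟪c.aMul (Θ t) (u t).field, v.field⟫_ℝ - ⟪p t, v.div⟫_ℝ + ⟪c.f3Sat (Θ t), v.field⟫_ℝ = 0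

/-- One step of the implicit Euler scheme: `(Θ, q, p, u)` solves the semi-discrete mixed problem
with step size `τ` and previous value `Θprev`. -/
structure IsSemiDiscreteStep {d : ℕ} (c : Coeffs d) (Ω : Set (Space d)) (τ : ℝ) (Θprev : L2 Ω)
    (Θ : L2 Ω) (q : Hdiv Ω) (p : L2 Ω) (u : Hdiv Ω) : Prop where
  mass : ∀ w : L2 Ω, ⟪c.sat Θ - c.sat Θprev, w⟫_ℝ + τ * ⟪q.div, w⟫_ℝ = 0
  flux : ∀ v : Hdiv Ω,
    ⟪q.field, v.field⟫_ℝ - ⟪Θ, v.div⟫_ℝ - ⟪c.fwMul Θ u.field, v.field⟫_ℝ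
      = ⟪c.f1Sat Θ, v.field⟫_ℝ
  totalMass : ∀ w : L2 Ω, ⟪u.div, w⟫_ℝ = ⟪c.f2Sat Θ, w⟫_ℝ
  darcy : ∀ v : Hdiv Ω,
    ⟪c.aMul Θ u.field, v.field⟫_ℝ - ⟪p, v.div⟫_ℝ + ⟪c.f3Sat Θ, v.field⟫_ℝ = 0

/-- `(Θⁿ, qⁿ, pⁿ, uⁿ)`, `1 ≤ n ≤ N`, solve the semi-discrete problems successively, starting from
`Θ⁰ = ΘI`. The values `q 0`, `p 0`, `u 0` and all values with index above `N` are irrelevant. -/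
def IsSemiDiscreteSolution {d : ℕ} (c : Coeffs d) (Ω : Set (Space d)) (τ : ℝ) (N : ℕ) (ΘI : L2 Ω)
    (Θ : ℕ → L2 Ω) (q : ℕ → Hdiv Ω) (p : ℕ → L2 Ω) (u : ℕ → Hdiv Ω) : Prop :=
  Θ 0 = ΘI ∧
    ∀ n ∈ Finset.Icc 1 N, IsSemiDiscreteStep c Ω τ (Θ (n - 1)) (Θ n) (q n) (p n) (u n)

/-- The `n`-th time point `t_n = n τ`. -/
def timePoint (τ : ℝ) (n : ℕ) : ℝ := n * τ

/-- The time average `τ⁻¹ ∫_{t_{n-1}}^{t_n} g(t) dt`, for `n ≥ 1`. -/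
def timeMean {X : Type*} [NormedAddCommGroup X] [NormedSpace ℝ X] (τ : ℝ) (g : ℝ → X) (n : ℕ) :
    X :=
  τ⁻¹ • ∫ t in timePoint τ (n - 1)..timePoint τ n, g t

end TwoPhase

end

noncomputable section

namespace TwoPhase

open Filter Topology

/-! The pressure problem is slaved to the saturation. The coercivity of `a` and a bounded right
inverse of the divergence, obtained from Poincaré's inequality by duality, bound every velocity
uniformly in `L²`. They also make `u` and `p` Lipschitz in `s(Θ)`, as long as one of the two
velocities compared is bounded in `L^∞` (`exists_darcy_lipschitz`); only the continuous one is.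
Hence the lower order flux `F = f_w(s(Θ)) u + f₁(s(Θ))` is bounded in `L²`, and the difference of
its continuous and discrete versions is at most `K ‖s(Θ) - s(Θⁿ)‖`. What remains is an abstract
problem in Hilbert spaces for a cocoercive map `S` with convex potential `Φ`.

A priori bounds come from the Legendre-type energy of `Φ`. No time derivative of `S(Θ)` is
available, so the flux equation is tested with backward differences of `Q`. Convexity makes the
result telescope, and a Fatou argument lets the step tend to zero (`integral_inner_le_of_window`,
`IsFlow.integral_norm_sq_le`). The discrete bound is the same computation with sums.

For the error (`IsFlow.step_le`), the flux equations are subtracted at almost every time `t` and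
tested with the accumulated flux error at `t_n`. This produces `S(Θ(t_n))` where the monotone term
needs `S(Θ(t))`. The flux equations themselves turn the mismatch into a pairing with `∫_t^{t_n} q`,
so no time regularity of `Θ` enters; after summation the a priori bounds make it `O(τ)`.
Cocoercivity absorbs the lower order terms, and an implicit Grönwall inequality closes the estimate
(`IsFlow.error_le`). The potential estimate then follows by testing with a preimage under the
divergence (`IsFlow.error_potential_le`), and the velocity and pressure estimates from Lipschitz
stability and Cauchy–Schwarz in time. -/

theorem aestronglyMeasurable_comp_of_ae_continuousAt {α E G : Type*} [MeasurableSpace α]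
    {μ : Measure α} [TopologicalSpace E] [TopologicalSpace G] [TopologicalSpace.PseudoMetrizableSpace G]
    {f : α → E} {g : E → G} (hf : AEStronglyMeasurable f μ)
    (hg : ∀ᵐ a ∂μ, ContinuousAt g (f a)) : AEStronglyMeasurable (fun a => g (f a)) μ := by
  obtain ⟨f', hf', hff'⟩ := hf
  refine aestronglyMeasurable_of_tendsto_ae atTop (f := fun n a => g (hf'.approx n a))
    (fun n => (SimpleFunc.stronglyMeasurable ((hf'.approx n).map g)).aestronglyMeasurable) ?_
  filter_upwards [hg, hff'] with a ha hfa
  exact ha.tendsto.comp (hfa ▸ hf'.tendsto_approx a)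

/-! ### Square integrable functions of time and sliding windows. -/

section Tools

variable {X : Type*} [NormedAddCommGroup X]

theorem integrable_norm_sq_of_memLp_two {α : Type*} [MeasurableSpace α] {μ : Measure α} {f : α → X}
    (hf : MemLp f 2 μ) : Integrable (fun t => ‖f t‖ ^ 2) μ :=
  (memLp_two_iff_integrable_sq_norm hf.1).1 hf

theorem intervalIntegrable_of_memLp_two {q : ℝ → X} (hq : MemLp q 2 volume) (a b : ℝ) :
    IntervalIntegrable q volume a b :=
  intervalIntegrable_iff.2
    (((hq.locallyIntegrable (by norm_num)).integrableOn_isCompact isCompact_uIcc).mono_set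
      uIoc_subset_uIcc)

variable [InnerProductSpace ℝ X]

theorem integrable_inner_of_memLp_two {α : Type*} [MeasurableSpace α] {μ : Measure α} {f g : α → X}
    (hf : MemLp f 2 μ) (hg : MemLp g 2 μ) : Integrable (fun t => ⟪f t, g t⟫_ℝ) μ := by
  refine ((integrable_norm_sq_of_memLp_two hf).add (integrable_norm_sq_of_memLp_two hg)).mono'
    (hf.1.inner hg.1) (Eventually.of_forall fun t => ?_)
  have h1 := abs_real_inner_le_norm (f t) (g t)
  have h2 := two_mul_le_add_sq ‖f t‖ ‖g t‖
  have h3 : 0 ≤ ‖f t‖ * ‖g t‖ := by positivity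
  simp only [Real.norm_eq_abs, Pi.add_apply]
  linarith

/-- The variance of `f` around its mean `m` is nonnegative. -/
theorem sq_intervalIntegral_le {f : ℝ → ℝ} {a b : ℝ} (hab : a ≤ b)
    (hf : IntervalIntegrable f volume a b)
    (hf2 : IntervalIntegrable (fun t => f t ^ 2) volume a b) :
    (∫ t in a..b, f t) ^ 2 ≤ (b - a) * ∫ t in a..b, f t ^ 2 := by
  rcases hab.eq_or_lt with rfl | hlt
  · simp
  set I := ∫ t in a..b, f t with hI
  set m := I / (b - a) with hm
  have hpos : 0 < b - a := sub_pos.2 hlt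
  have h0 : 0 ≤ ∫ t in a..b, (f t - m) ^ 2 :=
    intervalIntegral.integral_nonneg hab fun t _ => sq_nonneg _
  have h1 : ∫ t in a..b, (f t - m) ^ 2
      = (∫ t in a..b, f t ^ 2) - 2 * m * I + m ^ 2 * (b - a) := by
    have : ∀ t, (f t - m) ^ 2 = f t ^ 2 - 2 * m * f t + m ^ 2 := fun t => by ring
    simp_rw [this]
    rw [intervalIntegral.integral_add (hf2.sub (hf.const_mul _)) intervalIntegrable_const,
      intervalIntegral.integral_sub hf2 (hf.const_mul _), intervalIntegral.integral_const_mul,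
      intervalIntegral.integral_const, smul_eq_mul]
    ring
  have h2 : m * (b - a) = I := by rw [hm]; field_simp
  have h3 : 0 ≤ (b - a) * ((∫ t in a..b, f t ^ 2) - 2 * m * I + m ^ 2 * (b - a)) :=
    mul_nonneg hpos.le (h1 ▸ h0)
  nlinarith [h2]

theorem norm_sq_intervalIntegral_le {f : ℝ → X} {a b : ℝ} (hab : a ≤ b)
    (hf : IntervalIntegrable f volume a b)
    (hf2 : IntervalIntegrable (fun t => ‖f t‖ ^ 2) volume a b) :
    ‖∫ t in a..b, f t‖ ^ 2 ≤ (b - a) * ∫ t in a..b, ‖f t‖ ^ 2 :=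
  (pow_le_pow_left₀ (norm_nonneg _) (intervalIntegral.norm_integral_le_integral_norm hab) 2).trans
    (sq_intervalIntegral_le hab hf.norm hf2)

/-- The integral over the line of the sliding window integrals of `ψ` of width `h`. -/
theorem integral_window {ψ : ℝ → ℝ} (hψ : Integrable ψ) {h : ℝ} (hh : 0 ≤ h) :
    Integrable (fun t => ∫ y in (t - h)..t, ψ y) ∧
      ∫ t, ∫ y in (t - h)..t, ψ y = h * ∫ t, ψ t := by
  have hχ : Integrable ((Ioc 0 h).indicator (fun _ : ℝ => (1 : ℝ))) :=
    (integrable_indicator_iff measurableSet_Ioc).2 (integrableOn_const (by simp))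
  -- A window integral is a convolution with the indicator of `(0, h]`, so both claims reduce to
  -- Fubini for convolutions.
  have key : (fun t => ∫ y in (t - h)..t, ψ y)
      = convolution ((Ioc 0 h).indicator (fun _ : ℝ => (1 : ℝ))) ψ
        (ContinuousLinearMap.mul ℝ ℝ) volume := by
    funext t
    rw [convolution_def]
    have : ∀ r, (ContinuousLinearMap.mul ℝ ℝ) ((Ioc 0 h).indicator (fun _ : ℝ => (1 : ℝ)) r)
        (ψ (t - r)) = (Ioc 0 h).indicator (fun r => ψ (t - r)) r := by
      intro r
      by_cases hr : r ∈ Ioc 0 h <;> simp [hr]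
    simp_rw [this]
    rw [integral_indicator measurableSet_Ioc, ← intervalIntegral.integral_of_le hh,
      intervalIntegral.integral_comp_sub_left (fun y => ψ y) t, sub_zero]
  constructor
  · rw [key]
    exact hχ.integrable_convolution _ hψ
  · rw [key, integral_convolution _ hχ hψ, integral_indicator measurableSet_Ioc]
    simp [hh]

theorem norm_sq_window_le {q : ℝ → X} (hq : MemLp q 2 volume) {h : ℝ} (hh : 0 < h) (t : ℝ) :
    ‖∫ y in (t - h)..t, q y‖ ^ 2 ≤ h * ∫ y in (t - h)..t, ‖q y‖ ^ 2 := by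
  have := norm_sq_intervalIntegral_le (a := t - h) (b := t) (by linarith)
    (intervalIntegrable_of_memLp_two hq _ _)
    (integrable_norm_sq_of_memLp_two hq).intervalIntegrable
  simpa using this

theorem continuous_window {q : ℝ → X} (hq : MemLp q 2 volume) (h : ℝ) :
    Continuous fun t => ∫ y in (t - h)..t, q y := by
  have hii := intervalIntegrable_of_memLp_two hq
  have hF := intervalIntegral.continuous_primitive hii 0
  have : (fun t => ∫ y in (t - h)..t, q y)
      = fun t => (∫ y in (0 : ℝ)..t, q y) - ∫ y in (0 : ℝ)..(t - h), q y := by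
    funext t
    rw [intervalIntegral.integral_interval_sub_left (hii _ _) (hii _ _)]
  rw [this]
  exact hF.sub (hF.comp (continuous_id.sub continuous_const))

theorem memLp_window {q : ℝ → X} (hq : MemLp q 2 volume) {h : ℝ} (hh : 0 < h) :
    MemLp (fun t => ∫ y in (t - h)..t, q y) 2 volume := by
  have hcont := continuous_window hq h
  rw [memLp_two_iff_integrable_sq_norm hcont.aestronglyMeasurable]
  refine ((integral_window (integrable_norm_sq_of_memLp_two hq) hh.le).1.const_mul h).mono'
    (hcont.norm.pow 2).aestronglyMeasurable (Eventually.of_forall fun t => ?_)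
  rw [Real.norm_of_nonneg (by positivity)]
  exact norm_sq_window_le hq hh t

theorem integral_norm_sq_add {α : Type*} [MeasurableSpace α] {μ : Measure α} {v w : α → X}
    (hv : MemLp v 2 μ) (hw : MemLp w 2 μ) :
    ∫ t, ‖v t + w t‖ ^ 2 ∂μ
      = (∫ t, ‖v t‖ ^ 2 ∂μ) + 2 * (∫ t, ⟪v t, w t⟫_ℝ ∂μ) + ∫ t, ‖w t‖ ^ 2 ∂μ := by
  simp_rw [norm_add_sq_real]
  have h1 := integrable_norm_sq_of_memLp_two hv
  have h2 := (integrable_inner_of_memLp_two hv hw).const_mul 2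
  rw [integral_add (f := fun t => ‖v t‖ ^ 2 + 2 * ⟪v t, w t⟫_ℝ) (h1.add h2)
    (integrable_norm_sq_of_memLp_two hw), integral_add h1 h2, integral_const_mul]

/-- A bound on the pairing with backward difference quotients passes to the limit. -/
theorem integral_inner_le_of_window [CompleteSpace X] {q g : ℝ → X} {c : ℝ} (hq : MemLp q 2 volume)
    (hg : MemLp g 2 volume)
    (hc : ∀ h : ℝ, 0 < h → ∫ t, ⟪g t, ∫ y in (t - h)..t, q y⟫_ℝ ≤ h * c) :
    ∫ t, ⟪g t, q t⟫_ℝ ≤ c := by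
  have hloc : LocallyIntegrable q volume := hq.locallyIntegrable (by norm_num)
  have hii := intervalIntegrable_of_memLp_two hq
  have hq2 := integrable_norm_sq_of_memLp_two hq
  let D : ℝ → ℝ → X := fun h t => h⁻¹ • ∫ y in (t - h)..t, q y
  have hDmem : ∀ h, 0 < h → MemLp (D h) 2 volume := fun h hh => (memLp_window hq hh).const_smul _
  have hDsq : ∀ h, 0 < h → ∀ t, ‖D h t‖ ^ 2 ≤ h⁻¹ * ∫ y in (t - h)..t, ‖q y‖ ^ 2 := by
    intro h hh t
    simp only [D, norm_smul, mul_pow, norm_inv, Real.norm_eq_abs, abs_of_pos hh]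
    calc h⁻¹ ^ 2 * ‖∫ y in (t - h)..t, q y‖ ^ 2
        ≤ h⁻¹ ^ 2 * (h * ∫ y in (t - h)..t, ‖q y‖ ^ 2) := by
          gcongr; exact norm_sq_window_le hq hh t
      _ = _ := by field_simp
  have hDint : ∀ h, 0 < h → ∫ t, ‖D h t‖ ^ 2 ≤ ∫ t, ‖q t‖ ^ 2 := by
    intro h hh
    calc ∫ t, ‖D h t‖ ^ 2 ≤ ∫ t, h⁻¹ * ∫ y in (t - h)..t, ‖q y‖ ^ 2 :=
          integral_mono (integrable_norm_sq_of_memLp_two (hDmem h hh))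
            ((integral_window hq2 hh.le).1.const_mul h⁻¹) (hDsq h hh)
      _ = ∫ t, ‖q t‖ ^ 2 := by
          rw [integral_const_mul, (integral_window hq2 hh.le).2]
          field_simp
  set K := (∫ t, ‖g t‖ ^ 2) + 2 * c + ∫ t, ‖q t‖ ^ 2 with hK
  -- The pairing has no sign, so Fatou is applied to `‖g + D h‖²` instead. Since `D h` has no larger
  -- `L²` norm than `q`, the squares cancel in the limit and only the pairing survives.
  have hbound : ∀ h, 0 < h → ∫ t, ‖g t + D h t‖ ^ 2 ≤ K := by
    intro h hh
    rw [integral_norm_sq_add hg (hDmem h hh)]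
    have h1 : ∫ t, ⟪g t, D h t⟫_ℝ ≤ c := by
      simp only [D, real_inner_smul_right]
      rw [integral_const_mul]
      calc h⁻¹ * _ ≤ h⁻¹ * (h * c) := by gcongr; exact hc h hh
        _ = c := by field_simp
    have := hDint h hh
    linarith
  let e : ℕ → ℝ := fun k => 1 / ((k : ℝ) + 1)
  have he : ∀ k, 0 < e k := fun k => by positivity
  have hlim : ∀ᵐ t, Tendsto (fun k => D (e k) t) atTop (𝓝 (q t)) := by
    filter_upwards [LocallyIntegrable.ae_hasDerivAt_integral hloc] with t ht
    have h1 := (hasDerivAt_iff_tendsto_slope.1 (ht 0))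
    have h2 : Tendsto (fun k => t - e k) atTop (𝓝[≠] t) := by
      refine tendsto_nhdsWithin_iff.2 ⟨?_, Eventually.of_forall fun k => ?_⟩
      · simpa [e] using (tendsto_const_nhds (x := t)).sub tendsto_one_div_add_atTop_nhds_zero_nat
      · have := he k
        simp only [mem_compl_iff, mem_singleton_iff]
        intro h; linarith
    refine (h1.comp h2).congr fun k => ?_
    simp only [Function.comp, slope, D, vsub_eq_sub]
    rw [← intervalIntegral.integral_interval_sub_left (hii 0 t) (hii 0 (t - e k)),
      show t - e k - t = -(e k) by ring, inv_neg, neg_smul, ← smul_neg, neg_sub]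
  have hfat : ENNReal.ofReal (∫ t, ‖g t + q t‖ ^ 2) ≤ ENNReal.ofReal K := by
    have hqg := integrable_norm_sq_of_memLp_two (hg.add hq)
    simp only [Pi.add_apply] at hqg
    rw [ofReal_integral_eq_lintegral_ofReal hqg (Eventually.of_forall fun t => by positivity)]
    calc ∫⁻ t, ENNReal.ofReal (‖g t + q t‖ ^ 2)
        = ∫⁻ t, liminf (fun k => ENNReal.ofReal (‖g t + D (e k) t‖ ^ 2)) atTop := by
          refine lintegral_congr_ae ?_
          filter_upwards [hlim] with t ht
          exact (ENNReal.tendsto_ofReal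
            ((tendsto_const_nhds.add ht).norm.pow 2)).liminf_eq.symm
      _ ≤ liminf (fun k => ∫⁻ t, ENNReal.ofReal (‖g t + D (e k) t‖ ^ 2)) atTop :=
          lintegral_liminf_le' fun k => ((hg.1.add
            (hDmem _ (he k)).1).norm.pow 2).aemeasurable.ennreal_ofReal
      _ ≤ ENNReal.ofReal K := by
          refine liminf_le_of_frequently_le' (Eventually.frequently
            (Eventually.of_forall fun k => ?_))
          have hqg := integrable_norm_sq_of_memLp_two (hg.add (hDmem _ (he k)))
          simp only [Pi.add_apply] at hqg
          rw [← ofReal_integral_eq_lintegral_ofReal hqg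
            (Eventually.of_forall fun t => by positivity)]
          exact ENNReal.ofReal_le_ofReal (hbound _ (he k))
  have hK0 : 0 ≤ K := le_trans (integral_nonneg fun t => by positivity) (hbound 1 one_pos)
  have := (ENNReal.ofReal_le_ofReal_iff hK0).1 hfat
  rw [integral_norm_sq_add hg hq] at this
  linarith

end Tools

/-! ### Saturation maps, integrated flows and their a priori bounds. -/

section Abstract

variable {X Y V : Type*} [NormedAddCommGroup X] [InnerProductSpace ℝ X]
  [NormedAddCommGroup Y] [InnerProductSpace ℝ Y] [AddCommGroup V] [Module ℝ V]

/-- `S` is a bounded, cocoercive selection of subgradients of `Φ`. -/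
structure IsSaturationMap (S : Y → Y) (Φ : Y → ℝ) (L B : ℝ) : Prop where
  subgrad : ∀ x y, ⟪x - y, S y⟫_ℝ ≤ Φ x - Φ y
  bound : ∀ x, ‖S x‖ ≤ B
  cocoercive : ∀ x y, ‖S x - S y‖ ^ 2 ≤ L * ⟪S x - S y, x - y⟫_ℝ
  L_pos : 0 < L

/-- The Legendre-type energy `⟪x, S x⟫ - (Φ x - Φ 0)`. -/
def energy (S : Y → Y) (Φ : Y → ℝ) (x : Y) : ℝ := ⟪x, S x⟫_ℝ - (Φ x - Φ 0)

namespace IsSaturationMap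

variable {S : Y → Y} {Φ : Y → ℝ} {L B : ℝ}

theorem energy_nonneg (h : IsSaturationMap S Φ L B) (x : Y) : 0 ≤ energy S Φ x := by
  have := h.subgrad 0 x
  rw [zero_sub, inner_neg_left] at this
  unfold energy
  linarith

/-- Substitute for the chain rule `d/dt energy(Θ) = ⟪Θ, d/dt S(Θ)⟫`: it needs only the subgradient
inequality and no derivative in time. -/
theorem energy_sub_le (h : IsSaturationMap S Φ L B) (x y : Y) :
    energy S Φ x - energy S Φ y ≤ ⟪x, S x - S y⟫_ℝ := by
  have := h.subgrad x y
  rw [inner_sub_left] at this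
  unfold energy
  rw [inner_sub_right]
  linarith

theorem energy_le (h : IsSaturationMap S Φ L B) (x : Y) : energy S Φ x ≤ 2 * B * ‖x‖ := by
  have h1 := h.energy_sub_le x 0
  have h2 : energy S Φ (0 : Y) = 0 := by simp [energy]
  have h3 := real_inner_le_norm x (S x - S 0)
  have h4 : ‖S x - S 0‖ ≤ 2 * B := by
    linarith [norm_sub_le (S x) (S 0), h.bound x, h.bound 0]
  nlinarith [norm_nonneg x]

theorem norm_sub_le (h : IsSaturationMap S Φ L B) (x y : Y) : ‖S x - S y‖ ≤ L * ‖x - y‖ := by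
  have h1 := h.cocoercive x y
  have h2 := real_inner_le_norm (S x - S y) (x - y)
  rcases (norm_nonneg (S x - S y)).eq_or_lt with h0 | h0
  · rw [← h0]; exact mul_nonneg h.L_pos.le (norm_nonneg _)
  · have h3 : ‖S x - S y‖ * ‖S x - S y‖ ≤ ‖S x - S y‖ * (L * ‖x - y‖) := by
      nlinarith [h.L_pos.le]
    exact le_of_mul_le_mul_left h3 h0

theorem continuous (h : IsSaturationMap S Φ L B) : Continuous S := by
  refine (LipschitzWith.of_dist_le_mul (K := L.toNNReal) fun x y => ?_).continuous
  rw [dist_eq_norm, dist_eq_norm, Real.coe_toNNReal _ h.L_pos.le]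
  exact h.norm_sub_le x y

/-- The subgradients are bounded by `B`, so the potential is `B`-Lipschitz. -/
theorem continuous_potential (h : IsSaturationMap S Φ L B) : Continuous Φ := by
  have hB : 0 ≤ B := (norm_nonneg _).trans (h.bound 0)
  have key : ∀ x y, Φ x - Φ y ≤ B * ‖x - y‖ := by
    intro x y
    have h1 := h.subgrad y x
    have h2 := real_inner_le_norm (x - y) (S x)
    rw [← neg_sub x y, inner_neg_left] at h1
    have := mul_le_mul_of_nonneg_left (h.bound x) (norm_nonneg (x - y))
    linarith
  refine (LipschitzWith.of_dist_le_mul (K := B.toNNReal) fun x y => ?_).continuous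
  rw [dist_eq_norm, dist_eq_norm, Real.norm_eq_abs, abs_le]
  have h1 := key x y
  have h2 := key y x
  rw [norm_sub_rev] at h2
  rw [Real.coe_toNNReal _ hB]
  exact ⟨by linarith, h1⟩

theorem continuous_energy (h : IsSaturationMap S Φ L B) : Continuous (energy S Φ) :=
  (continuous_id.inner h.continuous).sub (h.continuous_potential.sub continuous_const)

end IsSaturationMap

/-- An integrated flow: saturation `S ∘ Θ`, flux `q` with primitive `φ ∘ Q`, and lower order
flux `F`. -/
structure IsFlow (φ : V →ₗ[ℝ] X) (δ : V →ₗ[ℝ] Y) (S : Y → Y) (T : ℝ) (ΘI : Y) (Bf : ℝ)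
    (Θ : ℝ → Y) (q F : ℝ → X) (Q : ℝ → V) : Prop where
  Θ_mem : MemLp Θ 2 (volume.restrict (Ioc 0 T))
  q_mem : MemLp q 2 (volume.restrict (Ioc 0 T))
  F_meas : AEStronglyMeasurable F (volume.restrict (Ioc 0 T))
  F_bdd : ∀ᵐ t ∂(volume.restrict (Ioc 0 T)), ‖F t‖ ≤ Bf
  prim : ∀ t ∈ Ioc 0 T, φ (Q t) = ∫ y in (0 : ℝ)..t, q y
  mass : ∀ t ∈ Ioc 0 T, S (Θ t) - S ΘI + δ (Q t) = 0
  flux : ∀ t ∈ Ioc 0 T, ∀ v, ⟪∫ y in (0 : ℝ)..t, q y, φ v⟫_ℝ - ⟪∫ y in (0 : ℝ)..t, Θ y, δ v⟫_ℝ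
    = ⟪∫ y in (0 : ℝ)..t, F y, φ v⟫_ℝ

/-- The implicit Euler discretization of an integrated flow. -/
structure IsEulerFlow (φ : V →ₗ[ℝ] X) (δ : V →ₗ[ℝ] Y) (S : Y → Y) (τ : ℝ) (N : ℕ) (ΘI : Y)
    (Bf : ℝ) (Θ : ℕ → Y) (q : ℕ → V) (F : ℕ → X) : Prop where
  initial : Θ 0 = ΘI
  F_bdd : ∀ n ∈ Finset.Icc 1 N, ‖F n‖ ≤ Bf
  mass : ∀ n ∈ Finset.Icc 1 N, S (Θ n) - S (Θ (n - 1)) + τ • δ (q n) = 0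
  flux : ∀ n ∈ Finset.Icc 1 N, ∀ v, ⟪φ (q n), φ v⟫_ℝ - ⟪Θ n, δ v⟫_ℝ = ⟪F n, φ v⟫_ℝ

theorem intervalIntegrable_of_integrableOn_Ioc {E : Type*} [NormedAddCommGroup E] {T a b : ℝ}
    {f : ℝ → E} (hf : IntegrableOn f (Ioc 0 T)) (ha : 0 ≤ a) (ha' : a ≤ T) (hb : 0 ≤ b)
    (hb' : b ≤ T) : IntervalIntegrable f volume a b :=
  intervalIntegrable_iff.2 (hf.mono_set fun _ hx =>
    ⟨(le_min ha hb).trans_lt hx.1, hx.2.trans (max_le ha' hb')⟩)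

variable {φ : V →ₗ[ℝ] X} {δ : V →ₗ[ℝ] Y} {S : Y → Y} {Φ : Y → ℝ} {L B T : ℝ} {ΘI : Y} {Bf : ℝ}

namespace IsFlow

variable {Θ : ℝ → Y} {q F : ℝ → X} {Q : ℝ → V}

theorem F_mem (h : IsFlow φ δ S T ΘI Bf Θ q F Q) : MemLp F 2 (volume.restrict (Ioc 0 T)) :=
  MemLp.of_bound h.F_meas Bf h.F_bdd

/-- Differentiates the integrated flux equation. The exceptional null set does not depend on `v`,
because the differentiability points of the primitives of `q`, `Θ` and `F` are chosen before pairing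
with `v`; this allows test elements that vary with time. The endpoint `T` is dropped since the
equation must hold on a neighbourhood. -/
theorem ae_flux [CompleteSpace X] [CompleteSpace Y] (h : IsFlow φ δ S T ΘI Bf Θ q F Q) :
    ∀ᵐ t ∂(volume.restrict (Ioc 0 T)), ∀ v, ⟪q t - F t, φ v⟫_ℝ = ⟪Θ t, δ v⟫_ℝ := by
  rcases le_or_gt T 0 with hT | hT
  · simp [Ioc_eq_empty_of_le hT]
  have hq := (intervalIntegrable_of_integrableOn_Ioc (h.q_mem.integrable (by norm_num)) le_rfl
    hT.le hT.le le_rfl).ae_hasDerivAt_integral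
  have hΘ := (intervalIntegrable_of_integrableOn_Ioc (h.Θ_mem.integrable (by norm_num)) le_rfl
    hT.le hT.le le_rfl).ae_hasDerivAt_integral
  have hF := (intervalIntegrable_of_integrableOn_Ioc (h.F_mem.integrable (by norm_num)) le_rfl
    hT.le hT.le le_rfl).ae_hasDerivAt_integral
  rw [uIcc_of_le hT.le] at hq hΘ hF
  have hTne : ∀ᵐ t : ℝ, t ≠ T := by simp [ae_iff]
  rw [ae_restrict_iff' measurableSet_Ioc]
  filter_upwards [hq, hΘ, hF, hTne] with t h1 h2 h3 h4 ht v
  have ht' : t ∈ Icc 0 T := Ioc_subset_Icc_self ht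
  have h0 : (0 : ℝ) ∈ Icc 0 T := left_mem_Icc.2 hT.le
  have d1 := (h1 ht' 0 h0).inner ℝ (hasDerivAt_const t (φ v))
  have d2 := (h2 ht' 0 h0).inner ℝ (hasDerivAt_const t (δ v))
  have d3 := (h3 ht' 0 h0).inner ℝ (hasDerivAt_const t (φ v))
  have hev : (fun r => ⟪∫ y in (0 : ℝ)..r, q y, φ v⟫_ℝ - ⟪∫ y in (0 : ℝ)..r, Θ y, δ v⟫_ℝ)
      =ᶠ[𝓝 t] fun r => ⟪∫ y in (0 : ℝ)..r, F y, φ v⟫_ℝ := by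
    filter_upwards [Ioo_mem_nhds ht.1 (lt_of_le_of_ne ht.2 h4)] with r hr
    exact h.flux r (Ioo_subset_Ioc_self hr) v
  have := ((d1.sub d2).congr_of_eventuallyEq hev.symm).unique d3
  simp only [inner_zero_right, zero_add] at this
  rw [inner_sub_left]
  linarith

/-- Testing with `Q(t) - Q(t - e)` bounds the pairing of `q - F` with the window integral of `q` by
a backward difference of the energy. Dividing by `e` and letting it tend to zero bounds `∫ ⟪q - F,
q⟫`, and Young's inequality removes `F`. -/
theorem integral_norm_sq_le [CompleteSpace X] [CompleteSpace Y] (hT : 0 < T)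
    (hS : IsSaturationMap S Φ L B)
    (h : IsFlow φ δ S T ΘI Bf Θ q F Q) :
    ∫ t in Ioc 0 T, ‖q t‖ ^ 2 ≤ 2 * energy S Φ ΘI + Bf ^ 2 * T := by
  let q' : ℝ → X := (Ioc 0 T).indicator q
  let g' : ℝ → X := (Ioc 0 T).indicator fun t => q t - F t
  have hq' : MemLp q' 2 volume := (memLp_indicator_iff_restrict measurableSet_Ioc).2 h.q_mem
  have hg : MemLp (fun t => q t - F t) 2 (volume.restrict (Ioc 0 T)) := h.q_mem.sub h.F_mem
  have hg' : MemLp g' 2 volume := (memLp_indicator_iff_restrict measurableSet_Ioc).2 hg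
  -- Windows near time zero reach negative times. Extending by zero flux and constant `ΘI` keeps the
  -- mass balance valid there; time zero itself belongs to the extension because `mass` starts after
  -- it.
  let Q' : ℝ → V := fun a => if 0 < a then Q a else 0
  let Θ' : ℝ → Y := fun a => if 0 < a then Θ a else ΘI
  let w : ℝ → ℝ := fun a => energy S Φ (Θ' a)
  have hw0 : ∀ a, 0 ≤ w a := fun a => hS.energy_nonneg _
  have hprim : ∀ a ≤ T, ∫ y in (0 : ℝ)..a, q' y = φ (Q' a) := by
    intro a ha
    by_cases h0 : 0 < a
    · simp only [Q', if_pos h0]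
      rw [h.prim a ⟨h0, ha⟩]
      refine intervalIntegral.integral_congr_ae (Eventually.of_forall fun y hy => ?_)
      rw [uIoc_of_le h0.le] at hy
      exact indicator_of_mem (show y ∈ Ioc 0 T from ⟨hy.1, hy.2.trans ha⟩) q
    · simp only [Q', if_neg h0, map_zero]
      refine intervalIntegral.integral_zero_ae (Eventually.of_forall fun y hy => ?_)
      rw [uIoc_of_ge (not_lt.1 h0)] at hy
      exact indicator_of_notMem (fun hy' => absurd hy'.1 (not_lt.2 hy.2)) q
  have hdiv : ∀ a ≤ T, δ (Q' a) = S ΘI - S (Θ' a) := by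
    intro a ha
    by_cases h0 : 0 < a
    · simp only [Q', Θ', if_pos h0]
      have := h.mass a ⟨h0, ha⟩
      rw [← sub_eq_zero, ← this]
      abel
    · simp [Q', Θ', if_neg h0]
  have hii := intervalIntegrable_of_memLp_two hq'
  have hwT : IntegrableOn w (Ioc 0 T) := by
    have : IntegrableOn (fun t => energy S Φ (Θ t)) (Ioc 0 T) := by
      refine ((h.Θ_mem.integrable (by norm_num)).norm.const_mul (2 * B)).mono'
        (hS.continuous_energy.comp_aestronglyMeasurable h.Θ_mem.1)
        (Eventually.of_forall fun t => ?_)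
      rw [Real.norm_of_nonneg (hS.energy_nonneg _)]
      exact hS.energy_le _
    refine this.congr_fun (fun t ht => ?_) measurableSet_Ioc
    simp [w, Θ', ht.1]
  have hwI : ∀ a ≤ 0, IntervalIntegrable w volume a 0 ∧
      ∫ t in a..0, w t = -a * energy S Φ ΘI := by
    intro a ha
    have hc : ∀ t ∈ Ioc a 0, energy S Φ ΘI = w t := fun t ht => by
      simp [w, Θ', not_lt.2 ht.2]
    constructor
    · rw [intervalIntegrable_iff_integrableOn_Ioc_of_le ha]
      exact (integrableOn_const (by simp)).congr_fun hc measurableSet_Ioc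
    · rw [intervalIntegral.integral_of_le ha, ← setIntegral_congr_fun measurableSet_Ioc hc]
      simp [ha]
  have hmain : ∫ t, ⟪g' t, q' t⟫_ℝ ≤ energy S Φ ΘI := by
    refine integral_inner_le_of_window hq' hg' fun e he => ?_
    have hind : (fun t => ⟪g' t, ∫ y in (t - e)..t, q' y⟫_ℝ)
        = (Ioc 0 T).indicator fun t => ⟪q t - F t, ∫ y in (t - e)..t, q' y⟫_ℝ := by
      funext t
      by_cases ht : t ∈ Ioc 0 T <;> simp [g', ht]
    rw [hind, integral_indicator measurableSet_Ioc]
    have hwe : IntervalIntegrable w volume (-e) T :=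
      (hwI (-e) (by linarith)).1.trans
        ((intervalIntegrable_iff_integrableOn_Ioc_of_le hT.le).2 hwT)
    have hsub : ∀ a b, -e ≤ a → a ≤ T → -e ≤ b → b ≤ T → IntervalIntegrable w volume a b := by
      intro a b ha ha' hb hb'
      refine hwe.mono_set ?_
      rw [uIcc_of_le (show -e ≤ T by linarith)]
      exact uIcc_subset_Icc ⟨ha, ha'⟩ ⟨hb, hb'⟩
    have hshift : IntervalIntegrable (fun t => w (t - e)) volume 0 T := by
      have := (hsub (-e) (T - e) le_rfl (by linarith) (by linarith) (by linarith)).comp_sub_right e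
      simpa using this
    calc ∫ t in Ioc 0 T, ⟪q t - F t, ∫ y in (t - e)..t, q' y⟫_ℝ
        ≤ ∫ t in Ioc 0 T, (w (t - e) - w t) := by
          refine integral_mono_ae
            (integrable_inner_of_memLp_two hg ((memLp_window hq' he).restrict _))
            (((intervalIntegrable_iff_integrableOn_Ioc_of_le hT.le).1 hshift).sub hwT) ?_
          filter_upwards [h.ae_flux, ae_restrict_mem measurableSet_Ioc] with t ht htm
          have hval : ∫ y in (t - e)..t, q' y = φ (Q' t - Q' (t - e)) := by
            rw [map_sub, ← hprim t htm.2, ← hprim (t - e) (by linarith [htm.2]),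
              intervalIntegral.integral_interval_sub_left (hii _ _) (hii _ _)]
          rw [hval, ht, map_sub, hdiv t htm.2, hdiv (t - e) (by linarith [htm.2])]
          have := hS.energy_sub_le (Θ' t) (Θ' (t - e))
          have hΘt : Θ t = Θ' t := by simp [Θ', htm.1]
          rw [hΘt, show S ΘI - S (Θ' t) - (S ΘI - S (Θ' (t - e)))
            = -(S (Θ' t) - S (Θ' (t - e))) by abel, inner_neg_right]
          simp only [w]
          linarith
      -- After the shift only two strips of width `e` remain. On the first the energy is that of
      -- `ΘI`; the second has a favourable sign.
      _ = (∫ t in (-e)..0, w t) - ∫ t in (T - e)..T, w t := by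
          rw [← intervalIntegral.integral_of_le hT.le, intervalIntegral.integral_sub hshift
            (hsub _ _ (by linarith) hT.le (by linarith) le_rfl),
            intervalIntegral.integral_comp_sub_right w e, zero_sub,
            intervalIntegral.integral_interval_sub_interval_comm
              (hsub _ _ le_rfl (by linarith) (by linarith) (by linarith))
              (hsub _ _ (by linarith) hT.le (by linarith) le_rfl)
              (hsub _ _ le_rfl (by linarith) (by linarith) hT.le)]
      _ ≤ e * energy S Φ ΘI := by
          rw [(hwI (-e) (by linarith)).2, neg_neg]
          have : 0 ≤ ∫ t in (T - e)..T, w t :=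
            intervalIntegral.integral_nonneg (by linarith) fun t _ => hw0 t
          linarith
  have hind : (fun t => ⟪g' t, q' t⟫_ℝ)
      = (Ioc 0 T).indicator fun t => ⟪q t - F t, q t⟫_ℝ := by
    funext t
    by_cases ht : t ∈ Ioc 0 T <;> simp [g', q', ht]
  rw [hind, integral_indicator measurableSet_Ioc] at hmain
  have hq2 := integrable_norm_sq_of_memLp_two h.q_mem
  have hcmp : ∫ t in Ioc 0 T, (‖q t‖ ^ 2 / 2 - Bf ^ 2 / 2) ≤ ∫ t in Ioc 0 T, ⟪q t - F t, q t⟫_ℝ := by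
    refine integral_mono_ae ((hq2.div_const 2).sub (integrable_const _))
      (integrable_inner_of_memLp_two hg h.q_mem) ?_
    filter_upwards [h.F_bdd] with t ht
    rw [inner_sub_left, real_inner_self_eq_norm_sq]
    have := real_inner_le_norm (F t) (q t)
    nlinarith [norm_nonneg (F t), norm_nonneg (q t), sq_nonneg (‖F t‖ - ‖q t‖)]
  rw [integral_sub (hq2.div_const 2) (integrable_const _), integral_div] at hcmp
  simp [hT.le] at hcmp
  linarith

end IsFlow

/-- Testing the flux equation with `q n` itself turns the divergence term into an increment of `S`,
and the energies telescope. -/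
theorem IsEulerFlow.sum_norm_sq_le {τ : ℝ} {N : ℕ} {Θ : ℕ → Y} {q : ℕ → V} {F : ℕ → X}
    (hτ : 0 ≤ τ) (hS : IsSaturationMap S Φ L B)
    (h : IsEulerFlow φ δ S τ N ΘI Bf Θ q F) :
    ∑ n ∈ Finset.Icc 1 N, τ * ‖φ (q n)‖ ^ 2 ≤ 2 * energy S Φ ΘI + Bf ^ 2 * (N * τ) := by
  have hstep : ∀ n ∈ Finset.Icc 1 N, τ * ‖φ (q n)‖ ^ 2
      ≤ 2 * (energy S Φ (Θ (n - 1)) - energy S Φ (Θ n)) + τ * Bf ^ 2 := by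
    intro n hn
    have h1 := h.flux n hn (q n)
    have h2 : τ • δ (q n) = -(S (Θ n) - S (Θ (n - 1))) := by
      rw [eq_neg_iff_add_eq_zero, add_comm]; exact h.mass n hn
    have h3 := hS.energy_sub_le (Θ n) (Θ (n - 1))
    have h4 : τ * ⟪Θ n, δ (q n)⟫_ℝ = -⟪Θ n, S (Θ n) - S (Θ (n - 1))⟫_ℝ := by
      rw [← real_inner_smul_right, h2, inner_neg_right]
    have h5 := real_inner_le_norm (F n) (φ (q n))
    have h6 := h.F_bdd n hn
    rw [real_inner_self_eq_norm_sq] at h1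
    have h7 : ⟪F n, φ (q n)⟫_ℝ ≤ ‖φ (q n)‖ ^ 2 / 2 + Bf ^ 2 / 2 := by
      nlinarith [norm_nonneg (F n), norm_nonneg (φ (q n)), sq_nonneg (‖F n‖ - ‖φ (q n)‖)]
    have h8 := mul_le_mul_of_nonneg_left h7 hτ
    nlinarith
  have htel : ∀ m : ℕ, ∑ n ∈ Finset.Icc 1 m,
      (2 * (energy S Φ (Θ (n - 1)) - energy S Φ (Θ n)) + τ * Bf ^ 2)
      = 2 * (energy S Φ (Θ 0) - energy S Φ (Θ m)) + m * (τ * Bf ^ 2) := by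
    intro m
    induction m with
    | zero => simp
    | succ m ih =>
      rw [Finset.sum_Icc_succ_top (by omega), ih, Nat.add_sub_cancel]
      push_cast
      ring
  refine (Finset.sum_le_sum hstep).trans ?_
  rw [htel, h.initial]
  have := hS.energy_nonneg (Θ N)
  linarith

end Abstract

/-! ### Discrete Grönwall inequality. -/

/-- A discrete Grönwall inequality for an implicit recursion. -/
theorem implicit_gronwall {x y r : ℕ → ℝ} {β R : ℝ} {N : ℕ} (hx0 : x 0 = 0)
    (hx : ∀ n, 0 ≤ x n) (hy : ∀ n, 0 ≤ y n) (hr : ∀ n, 0 ≤ r n) (hβ : 0 ≤ β) (hβ' : β ≤ 1 / 2)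
    (hR : ∑ n ∈ Finset.Icc 1 N, r n ≤ R)
    (hrec : ∀ n ∈ Finset.Icc 1 N, x n - x (n - 1) + y n ≤ β * x n + r n) :
    x N + ∑ n ∈ Finset.Icc 1 N, y n ≤ R * (1 + N * β * Real.exp (2 * (N * β))) := by
  have hgrow : ∀ m ≤ N, x m ≤ Real.exp (2 * (m * β)) * ∑ n ∈ Finset.Icc 1 m, r n := by
    intro m
    induction m with
    | zero => simp [hx0]
    | succ m ih =>
      intro hm
      have h1 := hrec (m + 1) (Finset.mem_Icc.2 ⟨by omega, hm⟩)
      rw [Nat.add_sub_cancel] at h1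
      -- For `β ≤ 1 / 2` the factor `1 + 2 * β` dominates `1 / (1 - β)`, which solves the implicit
      -- recursion for `x (m + 1)`.
      have h2 : x (m + 1) ≤ (1 + 2 * β) * (x m + r (m + 1)) := by
        have h3 : (1 - β) * x (m + 1) ≤ x m + r (m + 1) := by linarith [hy (m + 1)]
        have h4 := mul_le_mul_of_nonneg_left h3 (show 0 ≤ 1 + 2 * β by linarith)
        have h5 : 1 ≤ (1 + 2 * β) * (1 - β) := by nlinarith
        have h6 := mul_le_mul_of_nonneg_right h5 (hx (m + 1))
        linarith
      have hs : 0 ≤ ∑ n ∈ Finset.Icc 1 m, r n := Finset.sum_nonneg fun n _ => hr n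
      have he1 : 1 + 2 * β ≤ Real.exp (2 * β) := by linarith [Real.add_one_le_exp (2 * β)]
      have he2 : 1 ≤ Real.exp (2 * (m * β)) := Real.one_le_exp (by positivity)
      rw [Finset.sum_Icc_succ_top (by omega)]
      calc x (m + 1) ≤ (1 + 2 * β) * (x m + r (m + 1)) := h2
        _ ≤ Real.exp (2 * β) * (Real.exp (2 * (m * β)) * (∑ n ∈ Finset.Icc 1 m, r n)
              + Real.exp (2 * (m * β)) * r (m + 1)) := by
            refine mul_le_mul he1 (add_le_add (ih (by omega)) ?_) ?_ (Real.exp_pos _).le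
            · exact le_mul_of_one_le_left (hr _) he2
            · exact add_nonneg (hx _) (hr _)
        _ = _ := by
            rw [← mul_add, ← mul_assoc, ← Real.exp_add]
            congr 2
            push_cast
            ring
  have hR0 : 0 ≤ R := (Finset.sum_nonneg fun n _ => hr n).trans hR
  have hunif : ∀ n ∈ Finset.Icc 1 N, x n ≤ Real.exp (2 * (N * β)) * R := by
    intro n hn
    have hnN := (Finset.mem_Icc.1 hn).2
    refine (hgrow n hnN).trans (mul_le_mul ?_ ?_ (Finset.sum_nonneg fun n _ => hr n)
      (Real.exp_pos _).le)
    · gcongr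
    · exact (Finset.sum_le_sum_of_subset_of_nonneg
        (Finset.Icc_subset_Icc_right hnN) fun i _ _ => hr i).trans hR
  have htel : ∀ m : ℕ, ∑ n ∈ Finset.Icc 1 m, (x n - x (n - 1)) = x m := by
    intro m
    induction m with
    | zero => simp [hx0]
    | succ m ih => rw [Finset.sum_Icc_succ_top (by omega), ih, Nat.add_sub_cancel]; ring
  have h1 := Finset.sum_le_sum hrec
  rw [Finset.sum_add_distrib, htel, Finset.sum_add_distrib, ← Finset.mul_sum] at h1
  have h2 : ∑ n ∈ Finset.Icc 1 N, x n ≤ N * (Real.exp (2 * (N * β)) * R) := by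
    have := Finset.sum_le_card_nsmul _ _ _ hunif
    simpa using this
  have h3 := mul_le_mul_of_nonneg_left h2 hβ
  linarith

/-! ### Error inequality on a single time interval. -/

section Abstract

variable {X Y V : Type*} [NormedAddCommGroup X] [InnerProductSpace ℝ X]
  [NormedAddCommGroup Y] [InnerProductSpace ℝ Y] [AddCommGroup V] [Module ℝ V]
  {φ : V →ₗ[ℝ] X} {δ : V →ₗ[ℝ] Y} {S : Y → Y} {Φ : Y → ℝ} {L B T : ℝ} {ΘI : Y} {Bf K : ℝ}

theorem intervalIntegral_inner_const [CompleteSpace X] {f : ℝ → X} {a b : ℝ}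
    (hf : IntervalIntegrable f volume a b) (c : X) :
    ∫ t in a..b, ⟪f t, c⟫_ℝ = ⟪∫ t in a..b, f t, c⟫_ℝ := by
  have := (innerSL ℝ c).intervalIntegral_comp_comm hf
  simp only [innerSL_apply_apply] at this
  simp_rw [real_inner_comm c]
  exact this

namespace IsFlow

variable {Θ : ℝ → Y} {q F : ℝ → X} {Q : ℝ → V}

theorem integrable_saturation_inner (hS : IsSaturationMap S Φ L B)
    (h : IsFlow φ δ S T ΘI Bf Θ q F Q) (θ : Y) :
    IntegrableOn (fun t => ⟪S (Θ t) - S θ, Θ t - θ⟫_ℝ) (Ioc 0 T) := by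
  refine integrable_inner_of_memLp_two (MemLp.of_bound
    ((hS.continuous.comp_aestronglyMeasurable h.Θ_mem.1).sub aestronglyMeasurable_const) (B + B)
    (Eventually.of_forall fun t => ?_)) (h.Θ_mem.sub (memLp_const θ))
  exact (_root_.norm_sub_le _ _).trans (add_le_add (hS.bound _) (hS.bound _))

theorem integrable_saturation_sub_norm_sq (hS : IsSaturationMap S Φ L B)
    (h : IsFlow φ δ S T ΘI Bf Θ q F Q) (θ : Y) :
    IntegrableOn (fun t => ‖S (Θ t) - S θ‖ ^ 2) (Ioc 0 T) := by
  refine integrable_norm_sq_of_memLp_two (MemLp.of_bound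
    ((hS.continuous.comp_aestronglyMeasurable h.Θ_mem.1).sub aestronglyMeasurable_const) (B + B)
    (Eventually.of_forall fun t => ?_))
  exact (_root_.norm_sub_le _ _).trans (add_le_add (hS.bound _) (hS.bound _))

variable [CompleteSpace X] [CompleteSpace Y]

/-- The integrated flux equation for the error on one time interval. -/
theorem flux_sub (h : IsFlow φ δ S T ΘI Bf Θ q F Q)
    {a b : ℝ} (ha : 0 ≤ a) (hab : a ≤ b) (hb : b ≤ T) {θ : Y} {p f : X}
    (hflux : ∀ v, ⟪p, φ v⟫_ℝ - ⟪θ, δ v⟫_ℝ = ⟪f, φ v⟫_ℝ) (v : V) :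
    ⟪∫ t in a..b, (Θ t - θ), δ v⟫_ℝ
      = ⟪(∫ t in a..b, (q t - p)) - ∫ t in a..b, (F t - f), φ v⟫_ℝ := by
  have hΘ : IntervalIntegrable (fun t => Θ t - θ) volume a b :=
    (intervalIntegrable_of_integrableOn_Ioc (h.Θ_mem.integrable (by norm_num)) ha
      (hab.trans hb) (ha.trans hab) hb).sub intervalIntegrable_const
  have hq : IntervalIntegrable (fun t => q t - p) volume a b :=
    (intervalIntegrable_of_integrableOn_Ioc (h.q_mem.integrable (by norm_num)) ha
      (hab.trans hb) (ha.trans hab) hb).sub intervalIntegrable_const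
  have hF : IntervalIntegrable (fun t => F t - f) volume a b :=
    (intervalIntegrable_of_integrableOn_Ioc (h.F_mem.integrable (by norm_num)) ha
      (hab.trans hb) (ha.trans hab) hb).sub intervalIntegrable_const
  rw [← intervalIntegral.integral_sub hq hF, ← intervalIntegral_inner_const hΘ,
    ← intervalIntegral_inner_const (hq.sub hF)]
  refine intervalIntegral.integral_congr_ae ?_
  rw [uIoc_of_le hab]
  have hae := h.ae_flux
  rw [ae_restrict_iff' measurableSet_Ioc] at hae
  filter_upwards [hae] with t ht htm
  have h1 := ht ⟨ha.trans_lt htm.1, htm.2.trans hb⟩ v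
  have h2 := hflux v
  rw [inner_sub_left] at h1
  simp only [inner_sub_left]
  linarith

/-- The energy inequality for the error on one time interval. -/
theorem step_le (hS : IsSaturationMap S Φ L B) (h : IsFlow φ δ S T ΘI Bf Θ q F Q)
    {a b : ℝ} (ha : 0 ≤ a) (hab : a < b) (hb : b ≤ T) {θ : Y} {p f : X}
    (hflux : ∀ v, ⟪p, φ v⟫_ℝ - ⟪θ, δ v⟫_ℝ = ⟪f, φ v⟫_ℝ) (hf : ‖f‖ ≤ Bf)
    (hFK : ∀ᵐ t ∂(volume.restrict (Ioc 0 T)), ‖F t - f‖ ≤ K * ‖S (Θ t) - S θ‖)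
    {v : V} (hv : δ v = -(S (Θ b) - S θ)) :
    ⟪∫ t in a..b, (q t - p), φ v⟫_ℝ + (∫ t in a..b, ⟪S (Θ t) - S θ, Θ t - θ⟫_ℝ) / 2
      ≤ K ^ 2 * L / 2 * ((b - a) * ‖φ v‖ ^ 2)
        + (b - a) * (5 / 2 * (∫ t in a..b, ‖q t‖ ^ 2) + 2 * (b - a) * (‖p‖ ^ 2 + 2 * Bf ^ 2)) := by
  have hτ : 0 < b - a := sub_pos.2 hab
  have hq1 : IntegrableOn q (Ioc 0 T) := h.q_mem.integrable (by norm_num)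
  have hqi := intervalIntegrable_of_integrableOn_Ioc hq1 ha (hab.le.trans hb) (ha.trans hab.le) hb
  have hq2i : IntervalIntegrable (fun t => ‖q t‖ ^ 2) volume a b :=
    intervalIntegrable_of_integrableOn_Ioc (integrable_norm_sq_of_memLp_two h.q_mem) ha
      (hab.le.trans hb) (ha.trans hab.le) hb
  have hPi := intervalIntegrable_of_integrableOn_Ioc (h.integrable_saturation_inner hS θ) ha
    (hab.le.trans hb) (ha.trans hab.le) hb
  set J := ∫ t in a..b, ‖q t‖ with hJ
  have hJ0 : 0 ≤ J := intervalIntegral.integral_nonneg hab.le fun t _ => norm_nonneg _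
  have hJ2 : J ^ 2 ≤ (b - a) * ∫ t in a..b, ‖q t‖ ^ 2 := sq_intervalIntegral_le hab.le hqi.norm hq2i
  have hL := hS.L_pos
  have hpt : ∀ᵐ t ∂(volume.restrict (Ioc a b)),
      ⟪q t - p, φ v⟫_ℝ + ⟪S (Θ t) - S θ, Θ t - θ⟫_ℝ / 2
        ≤ K ^ 2 * L / 2 * ‖φ v‖ ^ 2 + J ^ 2 / (2 * (b - a))
          + 2 * (b - a) * (‖p‖ ^ 2 + 2 * Bf ^ 2) + 2 * (b - a) * ‖q t‖ ^ 2 := by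
    have hsub : Ioc a b ⊆ Ioc 0 T := Ioc_subset_Ioc ha hb
    filter_upwards [ae_restrict_of_ae_restrict_of_subset hsub h.ae_flux,
      ae_restrict_of_ae_restrict_of_subset hsub hFK,
      ae_restrict_of_ae_restrict_of_subset hsub h.F_bdd,
      ae_restrict_mem measurableSet_Ioc] with t ht hFt hFb htm
    have hb0 : b ∈ Ioc 0 T := ⟨ha.trans_lt hab, hb⟩
    have ht0 := hsub htm
    -- The difference of the two flux equations tested with `v`; the saturation appears at the right
    -- endpoint `b`, not at `t`.
    have e1 : ⟪q t - p, φ v⟫_ℝ + ⟪Θ t - θ, S (Θ b) - S θ⟫_ℝ = ⟪F t - f, φ v⟫_ℝ := by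
      have h1 := ht v
      have h2 := hflux v
      have h3 : ⟪Θ t - θ, δ v⟫_ℝ = -⟪Θ t - θ, S (Θ b) - S θ⟫_ℝ := by rw [hv, inner_neg_right]
      rw [inner_sub_left] at h1 h3
      simp only [inner_sub_left (q t), inner_sub_left (F t)]
      linarith
    have hδ : δ (Q b - Q t) = S (Θ t) - S (Θ b) := by
      have h1 := h.mass b hb0
      have h2 := h.mass t ht0
      rw [map_sub, ← sub_eq_zero]
      calc _ = (S (Θ b) - S ΘI + δ (Q b)) - (S (Θ t) - S ΘI + δ (Q t)) := by abel
        _ = 0 := by rw [h1, h2, sub_zero]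
    -- The mismatch between `b` and `t` is the divergence of `Q b - Q t`, so testing with that
    -- element rewrites it in terms of fluxes.
    have e2 : ⟪(q t - F t) - (p - f), φ (Q b - Q t)⟫_ℝ = ⟪Θ t - θ, S (Θ t) - S (Θ b)⟫_ℝ := by
      have h1 := ht (Q b - Q t)
      have h2 := hflux (Q b - Q t)
      rw [inner_sub_left (q t - F t), inner_sub_left p, h1, ← hδ, inner_sub_left (Θ t)]
      linarith
    have hφ : ‖φ (Q b - Q t)‖ ≤ J := by
      rw [map_sub, h.prim b hb0, h.prim t ht0, intervalIntegral.integral_interval_sub_left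
        (intervalIntegrable_of_integrableOn_Ioc hq1 le_rfl (hb0.1.le.trans hb) hb0.1.le hb)
        (intervalIntegrable_of_integrableOn_Ioc hq1 le_rfl (hb0.1.le.trans hb) ht0.1.le ht0.2)]
      refine (intervalIntegral.norm_integral_le_integral_norm htm.2).trans ?_
      exact intervalIntegral.integral_mono_interval htm.1.le htm.2 le_rfl
        (Eventually.of_forall fun t => norm_nonneg _) hqi.norm
    have e3 : ⟪S (Θ t) - S θ, Θ t - θ⟫_ℝ
        = ⟪Θ t - θ, S (Θ b) - S θ⟫_ℝ + ⟪Θ t - θ, S (Θ t) - S (Θ b)⟫_ℝ := by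
      rw [real_inner_comm, ← inner_add_right]
      congr 1
      abel
    -- Young's inequality weighted by `L`: cocoercivity lets half of the monotone term absorb the
    -- saturation difference.
    have b1 : ⟪F t - f, φ v⟫_ℝ ≤ ⟪S (Θ t) - S θ, Θ t - θ⟫_ℝ / 2 + K ^ 2 * L / 2 * ‖φ v‖ ^ 2 := by
      have h1 := real_inner_le_norm (F t - f) (φ v)
      have h2 := mul_le_mul_of_nonneg_right hFt (norm_nonneg (φ v))
      have h3 := hS.cocoercive (Θ t) θ
      set σ := ‖S (Θ t) - S θ‖
      have h4 : K * σ * ‖φ v‖ ≤ σ ^ 2 / L / 2 + K ^ 2 * L / 2 * ‖φ v‖ ^ 2 := by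
        have : 0 ≤ (σ - L * K * ‖φ v‖) ^ 2 / L / 2 := by positivity
        have h5 : (σ - L * K * ‖φ v‖) ^ 2 / L / 2
            = σ ^ 2 / L / 2 + K ^ 2 * L / 2 * ‖φ v‖ ^ 2 - K * σ * ‖φ v‖ := by
          field_simp
          ring
        linarith
      have h6 : σ ^ 2 / L ≤ ⟪S (Θ t) - S θ, Θ t - θ⟫_ℝ := by
        rw [div_le_iff₀ hL, mul_comm]; exact h3
      linarith
    -- Young's inequality weighted by the step size. Integrated over the interval, `J ^ 2 / (2 * (b
    -- - a))` becomes `J ^ 2 / 2`, which is at most half the step size times the integral of `‖q‖²`.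
    have b2 : ⟪(q t - F t) - (p - f), φ (Q b - Q t)⟫_ℝ
        ≤ J ^ 2 / (2 * (b - a)) + 2 * (b - a) * (‖p‖ ^ 2 + 2 * Bf ^ 2)
          + 2 * (b - a) * ‖q t‖ ^ 2 := by
      have h1 := real_inner_le_norm ((q t - F t) - (p - f)) (φ (Q b - Q t))
      set n := ‖(q t - F t) - (p - f)‖ with hn
      have hn0 : 0 ≤ n := norm_nonneg _
      have h2 : n ≤ ‖q t‖ + Bf + (‖p‖ + Bf) :=
        (_root_.norm_sub_le _ _).trans (add_le_add
          ((_root_.norm_sub_le _ _).trans (add_le_add le_rfl hFb))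
          ((_root_.norm_sub_le _ _).trans (add_le_add le_rfl hf)))
      have hBf : 0 ≤ Bf := (norm_nonneg _).trans hf
      have h3 : n ^ 2 ≤ 4 * (‖q t‖ ^ 2 + ‖p‖ ^ 2 + 2 * Bf ^ 2) := by
        have h4 := pow_le_pow_left₀ hn0 h2 2
        nlinarith [sq_nonneg (‖q t‖ - ‖p‖), sq_nonneg (‖q t‖ - Bf), sq_nonneg (‖p‖ - Bf)]
      have h4 : n * J ≤ J ^ 2 / (2 * (b - a)) + (b - a) / 2 * n ^ 2 := by
        have : 0 ≤ (J - (b - a) * n) ^ 2 / (2 * (b - a)) := by positivity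
        have h5 : (J - (b - a) * n) ^ 2 / (2 * (b - a))
            = J ^ 2 / (2 * (b - a)) + (b - a) / 2 * n ^ 2 - n * J := by
          field_simp
          ring
        linarith
      have h5 := mul_le_mul_of_nonneg_left hφ hn0
      have h6 := mul_le_mul_of_nonneg_left h3 hτ.le
      nlinarith
    linarith
  have hqp : IntervalIntegrable (fun t => q t - p) volume a b := hqi.sub intervalIntegrable_const
  have hqpv : IntervalIntegrable (fun t => ⟪q t - p, φ v⟫_ℝ) volume a b := by
    simp only [real_inner_comm (φ v)]
    exact ⟨(innerSL ℝ (φ v)).integrable_comp hqp.1, (innerSL ℝ (φ v)).integrable_comp hqp.2⟩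
  have hlhs := hqpv.add (hPi.div_const 2)
  have hrhs := (intervalIntegrable_const (μ := volume) (a := a) (b := b)
    (c := K ^ 2 * L / 2 * ‖φ v‖ ^ 2 + J ^ 2 / (2 * (b - a))
          + 2 * (b - a) * (‖p‖ ^ 2 + 2 * Bf ^ 2))).add (hq2i.const_mul (2 * (b - a)))
  have hcmp := integral_mono_ae hlhs.1 hrhs.1 hpt
  rw [← intervalIntegral.integral_of_le hab.le, ← intervalIntegral.integral_of_le hab.le,
    intervalIntegral.integral_add hqpv (hPi.div_const 2),
    intervalIntegral.integral_add intervalIntegrable_const (hq2i.const_mul _),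
    intervalIntegral_inner_const hqp, intervalIntegral.integral_div,
    intervalIntegral.integral_const_mul, intervalIntegral.integral_const, smul_eq_mul] at hcmp
  refine hcmp.trans ?_
  have hJ3 : (b - a) * (J ^ 2 / (2 * (b - a))) = J ^ 2 / 2 := by field_simp
  nlinarith

end IsFlow

end Abstract

/-! ### The uniform time grid. -/

theorem timePoint_zero (τ : ℝ) : timePoint τ 0 = 0 := by simp [timePoint]

theorem timePoint_mono {τ : ℝ} (hτ : 0 ≤ τ) : Monotone (timePoint τ) := fun m n hmn => by
  unfold timePoint
  gcongr

theorem timePoint_nonneg {τ : ℝ} (hτ : 0 ≤ τ) (n : ℕ) : 0 ≤ timePoint τ n := by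
  unfold timePoint
  positivity

theorem timePoint_sub_pred (τ : ℝ) {n : ℕ} (hn : 1 ≤ n) :
    timePoint τ n - timePoint τ (n - 1) = τ := by
  unfold timePoint
  rw [Nat.cast_sub hn]
  push_cast
  ring

theorem timePoint_le {τ T : ℝ} (hτ : 0 ≤ τ) {N n : ℕ} (hNτ : N * τ = T) (hn : n ≤ N) :
    timePoint τ n ≤ T :=
  hNτ ▸ timePoint_mono hτ hn

theorem sum_integral_timePoint {E : Type*} [NormedAddCommGroup E] [NormedSpace ℝ E] {f : ℝ → E}
    {τ T : ℝ} (hτ : 0 ≤ τ) {N : ℕ} (hNτ : N * τ = T) (hf : IntegrableOn f (Ioc 0 T)) {m : ℕ}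
    (hm : m ≤ N) :
    ∑ n ∈ Finset.Icc 1 m, ∫ t in timePoint τ (n - 1)..timePoint τ n, f t
      = ∫ t in (0 : ℝ)..timePoint τ m, f t := by
  have hT : 0 ≤ T := hNτ ▸ by positivity
  induction m with
  | zero => simp [timePoint_zero]
  | succ m ih =>
    have h1 := timePoint_le hτ hNτ hm
    have h2 := timePoint_le hτ hNτ (Nat.le_of_succ_le hm)
    rw [Finset.sum_Icc_succ_top (by omega), ih (by omega), Nat.add_sub_cancel,
      intervalIntegral.integral_add_adjacent_intervals]
    · exact intervalIntegrable_of_integrableOn_Ioc hf le_rfl hT (timePoint_nonneg hτ _) h2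
    · exact intervalIntegrable_of_integrableOn_Ioc hf (timePoint_nonneg hτ _) h2
        (timePoint_nonneg hτ _) h1

/-! ### Global error estimates for integrated flows. -/

section Abstract

variable {X Y V : Type*} [NormedAddCommGroup X] [InnerProductSpace ℝ X]
  [NormedAddCommGroup Y] [InnerProductSpace ℝ Y] [AddCommGroup V] [Module ℝ V]
  {φ : V →ₗ[ℝ] X} {δ : V →ₗ[ℝ] Y} {S : Y → Y} {Φ : Y → ℝ} {L B T : ℝ} {ΘI : Y} {Bf K : ℝ}
  {Θ : ℝ → Y} {q F : ℝ → X} {Q : ℝ → V} {Θn : ℕ → Y} {qn : ℕ → V} {Fn : ℕ → X} {N : ℕ} {τ : ℝ}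

theorem IsEulerFlow.sum_mass (hd : IsEulerFlow φ δ S τ N ΘI Bf Θn qn Fn) {m : ℕ} (hm : m ≤ N) :
    δ (τ • ∑ n ∈ Finset.Icc 1 m, qn n) = -(S (Θn m) - S ΘI) := by
  induction m with
  | zero => simp [hd.initial]
  | succ m ih =>
    have h1 := hd.mass (m + 1) (Finset.mem_Icc.2 ⟨by omega, hm⟩)
    rw [Nat.add_sub_cancel] at h1
    rw [Finset.sum_Icc_succ_top (by omega), smul_add, map_add, ih (by omega), map_smul,
      ← sub_eq_zero, ← h1]
    abel

/-- The accumulated flux error `∑ₙ ∫ (q - qⁿ)` up to step `m`. -/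
def fluxError (φ : V →ₗ[ℝ] X) (τ : ℝ) (q : ℝ → X) (qn : ℕ → V) (m : ℕ) : X :=
  ∑ n ∈ Finset.Icc 1 m, ∫ t in timePoint τ (n - 1)..timePoint τ n, (q t - φ (qn n))

/-- The accumulated flux error is the image of an element of `V`, hence an admissible test element,
whose divergence is minus the saturation error at `t_m`. -/
theorem IsFlow.fluxError_eq [CompleteSpace X] (h : IsFlow φ δ S T ΘI Bf Θ q F Q) (hτ : 0 < τ) (hNτ : N * τ = T)
    {m : ℕ} (hm1 : 1 ≤ m) (hm : m ≤ N) :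
    fluxError φ τ q qn m = φ (Q (timePoint τ m) - τ • ∑ n ∈ Finset.Icc 1 m, qn n) := by
  have hq1 : IntegrableOn q (Ioc 0 T) := h.q_mem.integrable (by norm_num)
  have hT : 0 ≤ T := hNτ ▸ by positivity
  have hm0 : 0 < timePoint τ m := by
    unfold timePoint
    positivity
  rw [map_sub, h.prim _ ⟨hm0, timePoint_le hτ.le hNτ hm⟩,
    ← sum_integral_timePoint hτ.le hNτ hq1 hm, map_smul, map_sum, Finset.smul_sum,
    ← Finset.sum_sub_distrib, fluxError]
  refine Finset.sum_congr rfl fun n hn => ?_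
  rw [Finset.mem_Icc] at hn
  rw [intervalIntegral.integral_sub _ intervalIntegrable_const, intervalIntegral.integral_const,
    timePoint_sub_pred τ hn.1]
  exact intervalIntegrable_of_integrableOn_Ioc hq1 (timePoint_nonneg hτ.le _)
    (timePoint_le hτ.le hNτ (by omega)) (timePoint_nonneg hτ.le _)
    (timePoint_le hτ.le hNτ (by omega))

/-- The error estimate for the saturation and the flux. -/
theorem IsFlow.error_le [CompleteSpace X] [CompleteSpace Y] (hT : 0 < T) (hS : IsSaturationMap S Φ L B)
    (h : IsFlow φ δ S T ΘI Bf Θ q F Q) (hτ : 0 < τ) (hNτ : N * τ = T)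
    (hsmall : K ^ 2 * L * τ ≤ 1 / 2) (hd : IsEulerFlow φ δ S τ N ΘI Bf Θn qn Fn)
    (hFK : ∀ n ∈ Finset.Icc 1 N, ∀ᵐ t ∂(volume.restrict (Ioc 0 T)),
      ‖F t - Fn n‖ ≤ K * ‖S (Θ t) - S (Θn n)‖) :
    (∑ n ∈ Finset.Icc 1 N, ∫ t in timePoint τ (n - 1)..timePoint τ n,
        ⟪S (Θ t) - S (Θn n), Θ t - Θn n⟫_ℝ)
      + ‖∑ n ∈ Finset.Icc 1 N, ∫ t in timePoint τ (n - 1)..timePoint τ n, (q t - φ (qn n))‖ ^ 2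
      + ∑ n ∈ Finset.Icc 1 N,
          ‖∫ t in timePoint τ (n - 1)..timePoint τ n, (q t - φ (qn n))‖ ^ 2
      ≤ τ * (18 * energy S Φ ΘI + 17 * (Bf ^ 2 * T))
        * (1 + K ^ 2 * L * T * Real.exp (2 * (K ^ 2 * L * T))) := by
  have hL := hS.L_pos
  let e : ℕ → X := fluxError φ τ q qn
  let D : ℕ → X := fun n => ∫ t in timePoint τ (n - 1)..timePoint τ n, (q t - φ (qn n))
  let P : ℕ → ℝ := fun n => ∫ t in timePoint τ (n - 1)..timePoint τ n,
    ⟪S (Θ t) - S (Θn n), Θ t - Θn n⟫_ℝ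
  let G : ℕ → ℝ := fun n => ∫ t in timePoint τ (n - 1)..timePoint τ n, ‖q t‖ ^ 2
  have hle : ∀ n, timePoint τ (n - 1) ≤ timePoint τ n := fun n =>
    timePoint_mono hτ.le (Nat.sub_le n 1)
  have hP0 : ∀ n, 0 ≤ P n := fun n => intervalIntegral.integral_nonneg (hle n) fun t _ =>
    nonneg_of_mul_nonneg_right ((sq_nonneg _).trans (hS.cocoercive (Θ t) (Θn n))) hL
  have hG0 : ∀ n, 0 ≤ G n := fun n => intervalIntegral.integral_nonneg (hle n) fun t _ =>
    sq_nonneg _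
  have hq2 := integrable_norm_sq_of_memLp_two h.q_mem
  have hNT : timePoint τ N = T := hNτ
  have hGsum : ∑ n ∈ Finset.Icc 1 N, G n ≤ 2 * energy S Φ ΘI + Bf ^ 2 * T := by
    rw [sum_integral_timePoint hτ.le hNτ hq2 le_rfl, hNT, intervalIntegral.integral_of_le hT.le]
    exact h.integral_norm_sq_le hT hS
  have hdsum := hd.sum_norm_sq_le hτ.le hS
  rw [hNτ] at hdsum
  -- Twice the remainder of `step_le`. The a priori bounds give the totals `18 = 5 * 2 + 4 * 2` and
  -- `17 = 5 + 4 + 8`.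
  let r : ℕ → ℝ := fun n => τ * (5 * G n + 4 * (τ * ‖φ (qn n)‖ ^ 2) + 8 * (τ * Bf ^ 2))
  have hrsum : ∑ n ∈ Finset.Icc 1 N, r n
      ≤ τ * (18 * energy S Φ ΘI + 17 * (Bf ^ 2 * T)) := by
    simp only [r]
    rw [← Finset.mul_sum, Finset.sum_add_distrib, Finset.sum_add_distrib, ← Finset.mul_sum,
      ← Finset.mul_sum, Finset.sum_const, Nat.card_Icc, Nat.add_sub_cancel, nsmul_eq_mul]
    refine mul_le_mul_of_nonneg_left ?_ hτ.le
    have : (N : ℝ) * (8 * (τ * Bf ^ 2)) = 8 * (Bf ^ 2 * T) := by rw [← hNτ]; ring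
    linarith
  have hrec : ∀ n ∈ Finset.Icc 1 N, ‖e n‖ ^ 2 - ‖e (n - 1)‖ ^ 2 + (‖D n‖ ^ 2 + P n)
      ≤ K ^ 2 * L * τ * ‖e n‖ ^ 2 + r n := by
    intro n hn
    have hn' := Finset.mem_Icc.1 hn
    have hpos : timePoint τ (n - 1) < timePoint τ n := by
      linarith [timePoint_sub_pred τ hn'.1]
    have hnT := timePoint_le hτ.le hNτ hn'.2
    have hen := h.fluxError_eq (qn := qn) hτ hNτ hn'.1 hn'.2
    have hv : δ (Q (timePoint τ n) - τ • ∑ j ∈ Finset.Icc 1 n, qn j)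
        = -(S (Θ (timePoint τ n)) - S (Θn n)) := by
      rw [map_sub, hd.sum_mass hn'.2, ← sub_eq_zero,
        ← h.mass _ ⟨(timePoint_nonneg hτ.le _).trans_lt hpos, hnT⟩]
      abel
    have hstep := h.step_le hS (timePoint_nonneg hτ.le _) hpos hnT (hd.flux n hn)
      (hd.F_bdd n hn) (hFK n hn) hv
    rw [← hen, timePoint_sub_pred τ hn'.1] at hstep
    -- Gives `2 ⟪D n, e n⟫ = ‖e n‖² - ‖e (n - 1)‖² + ‖D n‖²`, the source of the second and third
    -- terms of the estimate.
    have hsplit : e (n - 1) = e n - D n := by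
      obtain ⟨k, rfl⟩ : ∃ k, n = k + 1 := ⟨n - 1, by omega⟩
      simp only [e, D, fluxError]
      rw [Finset.sum_Icc_succ_top (by omega) (f := fun n =>
        ∫ t in timePoint τ (n - 1)..timePoint τ n, (q t - φ (qn n)))]
      simp
    rw [hsplit, norm_sub_sq_real, real_inner_comm]
    change ⟪D n, e n⟫_ℝ + P n / 2 ≤ K ^ 2 * L / 2 * (τ * ‖e n‖ ^ 2)
      + τ * (5 / 2 * G n + 2 * τ * (‖φ (qn n)‖ ^ 2 + 2 * Bf ^ 2)) at hstep
    simp only [r]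
    linarith
  have hβN : (N : ℝ) * (K ^ 2 * L * τ) = K ^ 2 * L * T := by rw [← hNτ]; ring
  have hgr := implicit_gronwall (x := fun n => ‖e n‖ ^ 2) (y := fun n => ‖D n‖ ^ 2 + P n) (r := r)
    (by simp [e, fluxError]) (fun n => sq_nonneg _) (fun n => add_nonneg (sq_nonneg _) (hP0 n))
    (fun n => by have := hG0 n; simp only [r]; positivity) (by positivity) hsmall hrsum hrec
  rw [hβN, Finset.sum_add_distrib] at hgr
  simp only [e, fluxError, D, P] at hgr
  linarith

/-- The error estimate for the time integral of the transformed pressure. -/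
theorem IsFlow.error_potential_le [CompleteSpace X] [CompleteSpace Y] (hS : IsSaturationMap S Φ L B)
    {Cd : ℝ} (hsurj : ∀ w, ∃ v, δ v = w ∧ ‖φ v‖ ≤ Cd * ‖w‖)
    (h : IsFlow φ δ S T ΘI Bf Θ q F Q) (hτ : 0 < τ) (hNτ : N * τ = T)
    (hd : IsEulerFlow φ δ S τ N ΘI Bf Θn qn Fn)
    (hFK : ∀ n ∈ Finset.Icc 1 N, ∀ᵐ t ∂(volume.restrict (Ioc 0 T)),
      ‖F t - Fn n‖ ≤ K * ‖S (Θ t) - S (Θn n)‖) :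
    ‖∑ n ∈ Finset.Icc 1 N, ∫ t in timePoint τ (n - 1)..timePoint τ n, (Θ t - Θn n)‖ ^ 2
      ≤ 2 * Cd ^ 2 * (‖∑ n ∈ Finset.Icc 1 N, ∫ t in timePoint τ (n - 1)..timePoint τ n,
          (q t - φ (qn n))‖ ^ 2
        + T * (K ^ 2 * L) * ∑ n ∈ Finset.Icc 1 N,
          ∫ t in timePoint τ (n - 1)..timePoint τ n, ⟪S (Θ t) - S (Θn n), Θ t - Θn n⟫_ℝ) := by
  set R := ∑ n ∈ Finset.Icc 1 N, ∫ t in timePoint τ (n - 1)..timePoint τ n, (Θ t - Θn n) with hR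
  set E := ∑ n ∈ Finset.Icc 1 N, ∫ t in timePoint τ (n - 1)..timePoint τ n, (q t - φ (qn n))
    with hE
  let H : ℕ → X := fun n => ∫ t in timePoint τ (n - 1)..timePoint τ n, (F t - Fn n)
  let P : ℕ → ℝ := fun n => ∫ t in timePoint τ (n - 1)..timePoint τ n,
    ⟪S (Θ t) - S (Θn n), Θ t - Θn n⟫_ℝ
  have hle : ∀ n, timePoint τ (n - 1) ≤ timePoint τ n := fun n =>
    timePoint_mono hτ.le (Nat.sub_le n 1)
  have hH : ∀ n ∈ Finset.Icc 1 N, ‖H n‖ ^ 2 ≤ τ * (K ^ 2 * L * P n) := by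
    intro n hn
    have hn' := Finset.mem_Icc.1 hn
    have hnT := timePoint_le hτ.le hNτ hn'.2
    have hFm : MemLp (fun t => F t - Fn n) 2 (volume.restrict (Ioc 0 T)) :=
      h.F_mem.sub (memLp_const _)
    have hF2 := intervalIntegrable_of_integrableOn_Ioc (integrable_norm_sq_of_memLp_two hFm)
      (timePoint_nonneg hτ.le (n - 1)) ((hle n).trans hnT) (timePoint_nonneg hτ.le n) hnT
    have hPi := intervalIntegrable_of_integrableOn_Ioc (h.integrable_saturation_inner hS (Θn n))
      (timePoint_nonneg hτ.le (n - 1)) ((hle n).trans hnT) (timePoint_nonneg hτ.le n) hnT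
    have h1 := norm_sq_intervalIntegral_le (hle n)
      (intervalIntegrable_of_integrableOn_Ioc (hFm.integrable (by norm_num))
        (timePoint_nonneg hτ.le (n - 1)) ((hle n).trans hnT) (timePoint_nonneg hτ.le n) hnT) hF2
    rw [timePoint_sub_pred τ hn'.1] at h1
    refine h1.trans (mul_le_mul_of_nonneg_left ?_ hτ.le)
    simp only [P]
    rw [← intervalIntegral.integral_const_mul, intervalIntegral.integral_of_le (hle n),
      intervalIntegral.integral_of_le (hle n)]
    refine integral_mono_ae hF2.1 (hPi.const_mul _).1 ?_
    filter_upwards [ae_restrict_of_ae_restrict_of_subset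
      (Ioc_subset_Ioc (timePoint_nonneg hτ.le (n - 1)) hnT) (hFK n hn)] with t ht
    have h2 := pow_le_pow_left₀ (norm_nonneg _) ht 2
    have h3 := mul_le_mul_of_nonneg_left (hS.cocoercive (Θ t) (Θn n)) (sq_nonneg K)
    rw [mul_pow] at h2
    linarith
  have hHsum : ‖∑ n ∈ Finset.Icc 1 N, H n‖ ^ 2
      ≤ T * (K ^ 2 * L) * ∑ n ∈ Finset.Icc 1 N, P n := by
    calc ‖∑ n ∈ Finset.Icc 1 N, H n‖ ^ 2 ≤ (∑ n ∈ Finset.Icc 1 N, ‖H n‖) ^ 2 :=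
          pow_le_pow_left₀ (norm_nonneg _) (norm_sum_le _ _) 2
      _ ≤ N * ∑ n ∈ Finset.Icc 1 N, ‖H n‖ ^ 2 := by
          simpa using sq_sum_le_card_mul_sum_sq (s := Finset.Icc 1 N) (f := fun n => ‖H n‖)
      _ ≤ N * ∑ n ∈ Finset.Icc 1 N, τ * (K ^ 2 * L * P n) :=
          mul_le_mul_of_nonneg_left (Finset.sum_le_sum hH) (by positivity)
      _ = _ := by rw [← hNτ, ← Finset.mul_sum, ← Finset.mul_sum]; ring
  -- Choosing a preimage of `R` under `δ` turns the summed flux equation into an identity for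
  -- `‖R‖²`.
  obtain ⟨v, hv, hvn⟩ := hsurj R
  have hRv : ⟪R, δ v⟫_ℝ = ⟪E - ∑ n ∈ Finset.Icc 1 N, H n, φ v⟫_ℝ := by
    rw [hR, hE, ← Finset.sum_sub_distrib, sum_inner, sum_inner]
    refine Finset.sum_congr rfl fun n hn => ?_
    exact h.flux_sub (timePoint_nonneg hτ.le _) (hle n)
      (timePoint_le hτ.le hNτ (Finset.mem_Icc.1 hn).2) (hd.flux n hn) v
  rw [hv, real_inner_self_eq_norm_sq] at hRv
  set Z := E - ∑ n ∈ Finset.Icc 1 N, H n with hZ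
  have hZ2 : ‖Z‖ ^ 2 ≤ 2 * (‖E‖ ^ 2 + ‖∑ n ∈ Finset.Icc 1 N, H n‖ ^ 2) := by
    have h1 := pow_le_pow_left₀ (norm_nonneg _) (norm_sub_le E (∑ n ∈ Finset.Icc 1 N, H n)) 2
    nlinarith [sq_nonneg (‖E‖ - ‖∑ n ∈ Finset.Icc 1 N, H n‖)]
  have h1 : ‖R‖ * ‖R‖ ≤ ‖R‖ * (Cd * ‖Z‖) := by
    have h2 := real_inner_le_norm Z (φ v)
    have h3 := mul_le_mul_of_nonneg_left hvn (norm_nonneg Z)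
    nlinarith
  have h2 : ‖R‖ ^ 2 ≤ Cd ^ 2 * ‖Z‖ ^ 2 := by
    rcases (norm_nonneg R).eq_or_lt with h0 | h0
    · rw [← h0, zero_pow two_ne_zero]; positivity
    · have := pow_le_pow_left₀ h0.le (le_of_mul_le_mul_left h1 h0) 2
      rwa [mul_pow] at this
  have h3 := mul_le_mul_of_nonneg_left hZ2 (sq_nonneg Cd)
  have h4 := mul_le_mul_of_nonneg_left hHsum (sq_nonneg Cd)
  simp only [P] at h4
  linarith

end Abstract

/-! ### A bounded right inverse of the divergence. -/

/-- If `‖b‖ ≤ C ‖a‖` along two linear maps with the same source, then functionals of `b` are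
represented by functionals of `a`. -/
theorem exists_inner_eq_of_norm_le {D X Y : Type*} [AddCommGroup D] [Module ℝ D]
    [NormedAddCommGroup X] [InnerProductSpace ℝ X] [CompleteSpace X]
    [NormedAddCommGroup Y] [InnerProductSpace ℝ Y] (A : D →ₗ[ℝ] X) (b : D →ₗ[ℝ] Y) {C : ℝ}
    (hC : 0 ≤ C) (hAb : ∀ x, ‖b x‖ ≤ C * ‖A x‖) (w : Y) :
    ∃ x : X, ‖x‖ ≤ C * ‖w‖ ∧ ∀ z, ⟪x, A z⟫_ℝ = ⟪w, b z⟫_ℝ := by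
  -- An arbitrary linear section of `A` over its range. The norm hypothesis makes `b (g (A z)) = b
  -- z` for any such section, so the functional is well defined and bounded; Hahn–Banach and Riesz
  -- then represent it.
  obtain ⟨g, hg⟩ := A.rangeRestrict.exists_rightInverse_of_surjective
    (LinearMap.range_eq_top.2 A.surjective_rangeRestrict)
  have hAg : ∀ y : LinearMap.range A, A (g y) = y := fun y =>
    congrArg Subtype.val (LinearMap.congr_fun hg y)
  let f : LinearMap.range A →ₗ[ℝ] ℝ := (innerₛₗ ℝ w).comp (b.comp g)
  have hf : ∀ y, ‖f y‖ ≤ C * ‖w‖ * ‖y‖ := by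
    intro y
    have h1 : |⟪w, b (g y)⟫_ℝ| ≤ ‖w‖ * ‖b (g y)‖ := abs_real_inner_le_norm _ _
    have h2 := hAb (g y)
    rw [hAg] at h2
    have h3 := mul_le_mul_of_nonneg_left h2 (norm_nonneg w)
    calc ‖f y‖ ≤ ‖w‖ * ‖b (g y)‖ := h1
      _ ≤ ‖w‖ * (C * ‖(y : X)‖) := h3
      _ = C * ‖w‖ * ‖y‖ := by rw [Submodule.coe_norm]; ring
  obtain ⟨ℓ, hℓ, hℓn⟩ := exists_extension_norm_eq _ (f.mkContinuous _ hf)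
  refine ⟨(InnerProductSpace.toDual ℝ X).symm ℓ, ?_, fun z => ?_⟩
  · rw [LinearIsometryEquiv.norm_map, hℓn]
    exact LinearMap.mkContinuous_norm_le _ (by positivity) _
  · rw [InnerProductSpace.toDual_symm_apply]
    have h1 := hℓ (A.rangeRestrict z)
    have h2 : b (g (A.rangeRestrict z)) = b z := by
      rw [← sub_eq_zero, ← map_sub, ← norm_le_zero_iff]
      refine (hAb _).trans ?_
      rw [map_sub, hAg]
      simp
    calc ℓ (A z) = ⟪w, b (g (A.rangeRestrict z))⟫_ℝ := h1
      _ = _ := by rw [h2]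

/-- Smooth functions with compact support in `Ω`. -/
def testSpace {d : ℕ} (Ω : Set (Space d)) : Submodule ℝ (Space d → ℝ) where
  carrier := {φ | ContDiff ℝ ∞ φ ∧ HasCompactSupport φ ∧ tsupport φ ⊆ Ω}
  add_mem' := fun hf hg => ⟨hf.1.add hg.1, hf.2.1.add hg.2.1,
    (tsupport_add _ _).trans (union_subset hf.2.2 hg.2.2)⟩
  zero_mem' := ⟨contDiff_const, HasCompactSupport.zero, by simp⟩
  smul_mem' := fun c f hf => ⟨contDiff_const.smul hf.1, hf.2.1.smul_left (f := fun _ => c),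
    (tsupport_smul_subset_right (fun _ => c) f).trans hf.2.2⟩

theorem norm_gradient {d : ℕ} (φ : Space d → ℝ) (x : Space d) :
    ‖gradient φ x‖ = ‖fderiv ℝ φ x‖ := by
  simp [gradient]

/-- Poincaré's inequality for test functions on a bounded set. -/
theorem poincare_testFun {d : ℕ} (hd : 1 ≤ d) {Ω : Set (Space d)}
    (hΩb : Bornology.IsBounded Ω) : ∃ C : ℝ, 0 ≤ C ∧
      ∀ φ : Space d → ℝ, ∀ h : ContDiff ℝ ∞ φ, ∀ hc : HasCompactSupport φ, tsupport φ ⊆ Ω →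
        ‖(testFun_memLp Ω h hc).toLp _‖ ≤ C * ‖(gradient_memLp Ω h hc).toLp _‖ := by
  obtain ⟨R, hR⟩ := hΩb.exists_norm_le
  refine ⟨2 * |R|, by positivity, fun φ h hc hs => ?_⟩
  let i : Fin d := ⟨0, hd⟩
  let ℓ : Space d →L[ℝ] ℝ := EuclideanSpace.proj i
  let e : Space d := EuclideanSpace.single i 1
  have hcont := h.continuous
  have hdiff : Differentiable ℝ φ := h.differentiable (by simp)
  have hdcont : Continuous fun x => fderiv ℝ φ x e :=
    (h.continuous_fderiv (by simp)).clm_apply continuous_const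
  have hsq : ∀ x, fderiv ℝ (fun y => φ y ^ 2) x e = 2 * (φ x * fderiv ℝ φ x e) := by
    intro x
    rw [fderiv_fun_pow 2 (hdiff x)]
    simp
    ring
  have hc2 : HasCompactSupport fun y => φ y ^ 2 := hc.comp_left (g := fun z : ℝ => z ^ 2) (by simp)
  have hℓe : ∀ x, fderiv ℝ ℓ x e = 1 := by
    intro x
    rw [ℓ.fderiv]
    simp [ℓ, e]
  have hcd : HasCompactSupport fun x => φ x * fderiv ℝ φ x e := hc.mul_right
  -- Integration by parts of `φ²` against the coordinate `ℓ`, whose derivative along `e` is one and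
  -- which is bounded by `|R|` on `Ω`.
  have hibp := integral_mul_fderiv_eq_neg_fderiv_mul_of_integrable (𝕜 := ℝ)
    (μ := (volume : Measure (Space d))) (f := ℓ)
    (g := fun y => φ y ^ 2) (v := e)
    (by simp_rw [hℓe, one_mul]; exact (hcont.pow 2).integrable_of_hasCompactSupport hc2)
    (by
      simp_rw [hsq]
      exact (ℓ.continuous.mul (continuous_const.mul (hcont.mul hdcont))).integrable_of_hasCompactSupport
        ((hcd.mul_left (f := fun _ => (2 : ℝ))).mul_left))
    ((ℓ.continuous.mul (hcont.pow 2)).integrable_of_hasCompactSupport hc2.mul_left)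
    (fun x _ => ℓ.differentiableAt) (fun x _ => (hdiff x).pow 2)
  simp_rw [hℓe, one_mul, hsq] at hibp
  have hout : ∀ x, x ∉ Ω → φ x = 0 := fun x hx =>
    image_eq_zero_of_notMem_tsupport fun hx' => hx (hs hx')
  have hset : ∀ g : Space d → ℝ, (∀ x, φ x = 0 → g x = 0) → ∫ x in Ω, g x = ∫ x, g x :=
    fun g hg => setIntegral_eq_integral_of_forall_compl_eq_zero fun x hx => hg x (hout x hx)
  rw [← hset _ (fun x hx => by simp [hx]), ← hset _ (fun x hx => by simp [hx])] at hibp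
  set f₁ := (testFun_memLp Ω h hc).toLp _ with hf₁
  set f₂ := (gradient_memLp Ω h hc).toLp _ with hf₂
  have hn1 : ‖f₁‖ ^ 2 = ∫ x in Ω, φ x ^ 2 := by
    rw [← real_inner_self_eq_norm_sq, ← integral_mul_testFun Ω h hc]
    refine integral_congr_ae ?_
    filter_upwards [(testFun_memLp Ω h hc).coeFn_toLp] with x hx
    rw [hx, sq]
  have hg1 : MemLp (fun x => |φ x|) 2 ((volume : Measure (Space d)).restrict Ω) :=
    (testFun_memLp Ω h hc).norm
  have hg2 : MemLp (fun x => ‖gradient φ x‖) 2 ((volume : Measure (Space d)).restrict Ω) :=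
    (gradient_memLp Ω h hc).norm
  have hpair : ∫ x in Ω, ‖gradient φ x‖ * |φ x| ≤ ‖f₁‖ * ‖f₂‖ := by
    have h1 := real_inner_le_norm (hg1.toLp _) (hg2.toLp _)
    rw [L2.inner_def] at h1
    have h2 : ‖hg1.toLp _‖ = ‖f₁‖ := by
      rw [hf₁, Lp.norm_toLp, Lp.norm_toLp]
      congr 1
      exact eLpNorm_norm φ
    have h3 : ‖hg2.toLp _‖ = ‖f₂‖ := by
      rw [hf₂, Lp.norm_toLp, Lp.norm_toLp]
      congr 1
      exact eLpNorm_norm (gradient φ)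
    rw [h2, h3] at h1
    refine le_trans (le_of_eq (integral_congr_ae ?_)) h1
    filter_upwards [hg1.coeFn_toLp, hg2.coeFn_toLp] with x hx hy
    rw [hx, hy]
    simp
  have hmeas : Integrable (fun x => ‖gradient φ x‖ * |φ x|)
      ((volume : Measure (Space d)).restrict Ω) := hg2.integrable_mul hg1
  have hnorm_e : ‖e‖ = 1 := by simp [e]
  have hΩae : ∀ x, |ℓ x * (2 * (φ x * fderiv ℝ φ x e))| ≤ 2 * |R| * (‖gradient φ x‖ * |φ x|) := by
    intro x
    by_cases hx : x ∈ Ω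
    · have h1 : |ℓ x| ≤ |R| := by
        have : ‖x i‖ ≤ ‖x‖ := PiLp.norm_apply_le x i
        exact this.trans ((hR x hx).trans (le_abs_self R))
      have h2 : |fderiv ℝ φ x e| ≤ ‖gradient φ x‖ := by
        rw [norm_gradient]
        simpa [hnorm_e] using (fderiv ℝ φ x).le_opNorm e
      rw [abs_mul, abs_mul, abs_mul, abs_two]
      calc |ℓ x| * (2 * (|φ x| * |fderiv ℝ φ x e|))
          ≤ |R| * (2 * (|φ x| * ‖gradient φ x‖)) := by gcongr
        _ = _ := by ring
    · simp [hout x hx]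
  have hmain : ‖f₁‖ ^ 2 ≤ 2 * |R| * (‖f₁‖ * ‖f₂‖) := by
    rw [hn1, ← neg_neg (∫ x in Ω, φ x ^ 2), ← hibp]
    refine (neg_le_abs _).trans (abs_integral_le_integral_abs.trans ?_)
    refine le_trans (integral_mono_of_nonneg (Eventually.of_forall fun x => abs_nonneg _)
      (hmeas.const_mul (2 * |R|)) (Eventually.of_forall hΩae)) ?_
    rw [integral_const_mul]
    gcongr
  rcases (norm_nonneg f₁).eq_or_lt with h0 | h0
  · rw [← h0]; positivity
  · refine le_of_mul_le_mul_left ?_ h0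
    linarith

/-- On a bounded set the divergence has a bounded right inverse. -/
theorem exists_div_eq {d : ℕ} (hd : 1 ≤ d) {Ω : Set (Space d)}
    (hΩb : Bornology.IsBounded Ω) : ∃ C : ℝ, 0 ≤ C ∧
      ∀ w : L2 Ω, ∃ v : Hdiv Ω, v.div = w ∧ ‖v.field‖ ≤ C * ‖w‖ := by
  obtain ⟨C, hC, hP⟩ := poincare_testFun hd hΩb
  refine ⟨C, hC, fun w => ?_⟩
  let A : testSpace Ω →ₗ[ℝ] L2vec Ω :=
    { toFun := fun φ => (gradient_memLp Ω φ.2.1 φ.2.2.1).toLp _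
      map_add' := fun φ ψ => by
        rw [← MemLp.toLp_add]
        refine MemLp.toLp_congr _ _ (Eventually.of_forall fun x => ?_)
        simp only [gradient, Submodule.coe_add, Pi.add_apply]
        rw [← map_add, fderiv_add (φ.2.1.differentiable (by simp) x)
          (ψ.2.1.differentiable (by simp) x)]
      map_smul' := fun c φ => by
        rw [RingHom.id_apply, ← MemLp.toLp_const_smul]
        refine MemLp.toLp_congr _ _ (Eventually.of_forall fun x => ?_)
        simp only [gradient, Submodule.coe_smul, Pi.smul_apply]
        rw [fderiv_const_smul (φ.2.1.differentiable (by simp) x)]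
        simp }
  let b : testSpace Ω →ₗ[ℝ] L2 Ω :=
    { toFun := fun φ => (testFun_memLp Ω φ.2.1 φ.2.2.1).toLp _
      map_add' := fun φ ψ => by
        rw [← MemLp.toLp_add]
        rfl
      map_smul' := fun c φ => by
        rw [RingHom.id_apply, ← MemLp.toLp_const_smul]
        rfl }
  -- With `-w`, the representation identity on gradients is exactly the definition of `w` as the
  -- distributional divergence of `x`.
  obtain ⟨x, hx, hxz⟩ := exists_inner_eq_of_norm_le A b hC
    (fun φ => hP _ φ.2.1 φ.2.2.1 φ.2.2.2) (-w)
  rw [norm_neg] at hx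
  refine ⟨⟨WithLp.toLp 2 (x, w), ?_⟩, rfl, hx⟩
  intro φ h hc hs
  rw [integral_inner_gradient Ω h hc, integral_mul_testFun Ω h hc]
  have := hxz ⟨φ, h, hc, hs⟩
  rw [inner_neg_left] at this
  exact this

/-! ### Superposition operators on `L²(Ω)`. -/

section Spatial

variable {d : ℕ} {Ω : Set (Space d)} {c : Coeffs d} {F : Type*} [NormedAddCommGroup F]

theorem coeFn_toL2 {g : Space d → F} (h : MemLp g 2 ((volume : Measure (Space d)).restrict Ω)) :
    toL2 Ω g =ᵐ[(volume : Measure (Space d)).restrict Ω] g := by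
  rw [toL2, dif_pos h]
  exact h.coeFn_toLp

theorem Coeffs.Admissible.coeFn_sat (hc : c.Admissible) (hΩb : Bornology.IsBounded Ω) (θ : L2 Ω) :
    c.sat θ =ᵐ[(volume : Measure (Space d)).restrict Ω] fun x => c.s (θ x) :=
  coeFn_toL2 (hc.memLp_comp hΩb continuous_id θ)

theorem Coeffs.Admissible.norm_toL2_comp_sub_le (hc : c.Admissible)
    (hΩb : Bornology.IsBounded Ω) {g : ℝ → F} {K : NNReal} (hg : LipschitzWith K g)
    (θ θ' : L2 Ω) :
    ‖toL2 Ω (fun x => g (c.s (θ x))) - toL2 Ω (fun x => g (c.s (θ' x)))‖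
      ≤ K * ‖c.sat θ - c.sat θ'‖ := by
  refine Lp.norm_le_mul_norm_of_ae_le_mul ?_
  filter_upwards [Lp.coeFn_sub (toL2 Ω (fun x => g (c.s (θ x)))) (toL2 Ω (fun x => g (c.s (θ' x)))),
    Lp.coeFn_sub (c.sat θ) (c.sat θ'), coeFn_toL2 (hc.memLp_comp hΩb hg.continuous θ),
    coeFn_toL2 (hc.memLp_comp hΩb hg.continuous θ'), hc.coeFn_sat hΩb θ, hc.coeFn_sat hΩb θ']
    with x h1 h2 h3 h4 h5 h6
  rw [h1, h2, Pi.sub_apply, Pi.sub_apply, h3, h4, h5, h6, ← dist_eq_norm, ← dist_eq_norm]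
  exact hg.dist_le_mul _ _

theorem Coeffs.Admissible.exists_norm_toL2_comp_le (hc : c.Admissible)
    (hΩb : Bornology.IsBounded Ω) {g : ℝ → F} (hg : Continuous g) :
    ∃ B, ∀ θ : L2 Ω, ‖toL2 Ω (fun x => g (c.s (θ x)))‖ ≤ B := by
  obtain ⟨M, hM⟩ := (isCompact_Icc (a := (0 : ℝ)) (b := 1)).exists_bound_of_continuousOn
    hg.continuousOn
  have hM0 : 0 ≤ M := (norm_nonneg _).trans (hM 0 (by simp))
  have : IsFiniteMeasure ((volume : Measure (Space d)).restrict Ω) :=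
    ⟨by simpa using hΩb.measure_lt_top⟩
  refine ⟨_, fun θ => Lp.norm_le_of_ae_bound hM0 ?_⟩
  filter_upwards [coeFn_toL2 (hc.memLp_comp hΩb hg θ)] with x hx
  rw [hx]
  exact hM _ (hc.s_mem _)

theorem Coeffs.Admissible.toL2_smul_sub (hc : c.Admissible) {g : ℝ → ℝ} (hg : Continuous g)
    (θ : L2 Ω) (v v' : L2vec Ω) :
    toL2 Ω (fun x => g (c.s (θ x)) • (v - v') x)
      = toL2 Ω (fun x => g (c.s (θ x)) • v x) - toL2 Ω (fun x => g (c.s (θ x)) • v' x) := by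
  refine Lp.ext ?_
  filter_upwards [Lp.coeFn_sub (toL2 Ω (fun x => g (c.s (θ x)) • v x))
    (toL2 Ω (fun x => g (c.s (θ x)) • v' x)), Lp.coeFn_sub v v',
    coeFn_toL2 (hc.memLp_smul hg θ v), coeFn_toL2 (hc.memLp_smul hg θ v'),
    coeFn_toL2 (hc.memLp_smul hg θ (v - v'))] with x h1 h2 h3 h4 h5
  rw [h1, h5, Pi.sub_apply, h3, h4, h2, Pi.sub_apply, smul_sub]

theorem Coeffs.Admissible.norm_toL2_smul_le (hc : c.Admissible) {g : ℝ → ℝ} (hg : Continuous g)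
    {M : ℝ} (hM : ∀ y, |g y| ≤ M) (θ : L2 Ω) (v : L2vec Ω) :
    ‖toL2 Ω (fun x => g (c.s (θ x)) • v x)‖ ≤ M * ‖v‖ := by
  refine Lp.norm_le_mul_norm_of_ae_le_mul ?_
  filter_upwards [coeFn_toL2 (hc.memLp_smul hg θ v)] with x hx
  rw [hx, norm_smul]
  exact mul_le_mul_of_nonneg_right (hM _) (norm_nonneg _)

/-- The coefficient difference is controlled only in `L²` by the saturation difference, so its
product with `v` needs a pointwise bound on `v`. This is where the bound on the continuous velocity
enters. -/
theorem Coeffs.Admissible.norm_toL2_smul_sub_le (hc : c.Admissible)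
    (hΩb : Bornology.IsBounded Ω) {g : ℝ → ℝ} {K : NNReal} (hg : LipschitzWith K g) {M : ℝ}
    (θ θ' : L2 Ω) {v : L2vec Ω}
    (hv : ∀ᵐ x ∂((volume : Measure (Space d)).restrict Ω), ‖v x‖ ≤ M) :
    ‖toL2 Ω (fun x => g (c.s (θ x)) • v x) - toL2 Ω (fun x => g (c.s (θ' x)) • v x)‖
      ≤ K * M * ‖c.sat θ - c.sat θ'‖ := by
  refine Lp.norm_le_mul_norm_of_ae_le_mul ?_
  filter_upwards [Lp.coeFn_sub (toL2 Ω (fun x => g (c.s (θ x)) • v x))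
    (toL2 Ω (fun x => g (c.s (θ' x)) • v x)), Lp.coeFn_sub (c.sat θ) (c.sat θ'),
    coeFn_toL2 (hc.memLp_smul hg.continuous θ v), coeFn_toL2 (hc.memLp_smul hg.continuous θ' v),
    hc.coeFn_sat hΩb θ, hc.coeFn_sat hΩb θ', hv] with x h1 h2 h3 h4 h5 h6 h7
  rw [h1, h2, Pi.sub_apply, Pi.sub_apply, h3, h4, h5, h6, ← sub_smul, norm_smul]
  have h8 : ‖g (c.s (θ x)) - g (c.s (θ' x))‖ ≤ K * ‖c.s (θ x) - c.s (θ' x)‖ := by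
    rw [← dist_eq_norm, ← dist_eq_norm]
    exact hg.dist_le_mul _ _
  calc _ ≤ K * ‖c.s (θ x) - c.s (θ' x)‖ * M := by gcongr
    _ = _ := by ring

theorem Coeffs.Admissible.le_inner_aMul (hc : c.Admissible) {m : ℝ} (hm : ∀ y, m ≤ c.a y)
    (θ : L2 Ω) (v : L2vec Ω) : m * ‖v‖ ^ 2 ≤ ⟪c.aMul θ v, v⟫_ℝ := by
  obtain ⟨K, hK⟩ := hc.a_lip
  rw [← real_inner_self_eq_norm_sq, L2.inner_def, L2.inner_def, ← integral_const_mul]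
  refine integral_mono_ae ((L2.integrable_inner v v).const_mul m) (L2.integrable_inner _ _) ?_
  filter_upwards [coeFn_toL2 (hc.memLp_smul hK.continuous θ v)] with x hx
  rw [show (c.aMul θ v : Space d → Space d) x = c.a (c.s (θ x)) • v x from hx,
    real_inner_smul_left]
  exact mul_le_mul_of_nonneg_right (hm _) real_inner_self_nonneg

/-- The primitive of a nondecreasing function is convex. -/
theorem sub_mul_le_primitive_sub {s : ℝ → ℝ} (hs : Monotone s) (x y : ℝ) :
    (x - y) * s y ≤ (∫ r in (0 : ℝ)..x, s r) - ∫ r in (0 : ℝ)..y, s r := by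
  have hi : ∀ a b, IntervalIntegrable s volume a b := fun a b => hs.intervalIntegrable
  rw [intervalIntegral.integral_interval_sub_left (hi _ _) (hi _ _)]
  rcases le_total y x with h | h
  · have := intervalIntegral.integral_mono_on (μ := volume) h
      (intervalIntegrable_const (c := s y)) (hi y x) fun r hr => hs hr.1
    simpa using this
  · have := intervalIntegral.integral_mono_on (μ := volume) h (hi x y)
      (intervalIntegrable_const (c := s y)) fun r hr => hs hr.2
    rw [intervalIntegral.integral_symm]
    simp only [intervalIntegral.integral_const, smul_eq_mul] at this
    linarith

/-- The potential integrates the convex primitive of `s` over `Ω`. Cocoercivity is pointwise: a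
monotone `K`-Lipschitz `s` satisfies `(s x - s y)² ≤ K (s x - s y)(x - y)`. -/
theorem Coeffs.Admissible.exists_isSaturationMap (hc : c.Admissible)
    (hΩb : Bornology.IsBounded Ω) :
    ∃ (Φ : L2 Ω → ℝ) (L B : ℝ), IsSaturationMap (c.sat : L2 Ω → L2 Ω) Φ L B := by
  obtain ⟨K, hK⟩ := hc.s_lip
  obtain ⟨B, hB⟩ := hc.exists_norm_toL2_comp_le hΩb continuous_id
  have hfin : IsFiniteMeasure ((volume : Measure (Space d)).restrict Ω) :=
    ⟨by simpa using hΩb.measure_lt_top⟩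
  let ψ : ℝ → ℝ := fun y => ∫ r in (0 : ℝ)..y, c.s r
  have hψc : Continuous ψ :=
    intervalIntegral.continuous_primitive (fun a b => hc.s_mono.intervalIntegrable) 0
  have hψb : ∀ y, ‖ψ y‖ ≤ ‖y‖ := by
    intro y
    have := intervalIntegral.norm_integral_le_of_norm_le_const (a := 0) (b := y) (f := c.s)
      (C := 1) fun r _ => by
        rw [Real.norm_of_nonneg (hc.s_mem r).1]; exact (hc.s_mem r).2
    simpa using this
  have hψi : ∀ θ : L2 Ω, Integrable (fun x => ψ (θ x))
      ((volume : Measure (Space d)).restrict Ω) := fun θ =>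
    ((Lp.memLp θ).integrable (by norm_num)).mono
      (hψc.comp_aestronglyMeasurable (Lp.aestronglyMeasurable θ))
      (Eventually.of_forall fun x => hψb _)
  -- `K + 1` rather than `K`, so that the cocoercivity constant is positive even when `s` is
  -- constant.
  refine ⟨fun θ => ∫ x in Ω, ψ (θ x), K + 1, B, ⟨fun x y => ?_, hB, fun x y => ?_, by positivity⟩⟩
  · rw [L2.inner_def, ← integral_sub (hψi x) (hψi y)]
    refine integral_mono_ae (L2.integrable_inner _ _) ((hψi x).sub (hψi y)) ?_
    filter_upwards [hc.coeFn_sat hΩb y, Lp.coeFn_sub x y] with z h1 h2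
    rw [h1, h2]
    have := sub_mul_le_primitive_sub hc.s_mono (x z) (y z)
    simpa [ψ, mul_comm] using this
  · rw [← real_inner_self_eq_norm_sq, L2.inner_def, L2.inner_def, ← integral_const_mul]
    refine integral_mono_ae (L2.integrable_inner _ _) ((L2.integrable_inner _ _).const_mul _) ?_
    filter_upwards [hc.coeFn_sat hΩb x, hc.coeFn_sat hΩb y, Lp.coeFn_sub x y,
      Lp.coeFn_sub (c.sat x) (c.sat y)] with z h1 h2 h3 h4
    simp only [h3, h4, Pi.sub_apply, h1, h2]
    have h5 := hK.dist_le_mul (x z) (y z)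
    rw [Real.dist_eq, Real.dist_eq] at h5
    simp only [RCLike.inner_apply, conj_trivial]
    rcases le_total (y z) (x z) with h | h
    · have h6 := hc.s_mono h
      rw [abs_of_nonneg (by linarith), abs_of_nonneg (by linarith)] at h5
      have h7 := mul_le_mul_of_nonneg_left h5 (sub_nonneg.2 h6)
      have h8 := mul_nonneg (sub_nonneg.2 h) (sub_nonneg.2 h6)
      linarith
    · have h6 := hc.s_mono h
      rw [abs_of_nonpos (by linarith), abs_of_nonpos (by linarith)] at h5
      have h7 := mul_le_mul_of_nonneg_left h5 (sub_nonneg.2 h6)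
      have h8 := mul_nonneg (sub_nonneg.2 h) (sub_nonneg.2 h6)
      linarith

/-- The field of an element of `H(div; Ω)`, as a linear map. -/
def fieldₗ (Ω : Set (Space d)) : Hdiv Ω →ₗ[ℝ] L2vec Ω where
  toFun := Hdiv.field
  map_add' _ _ := rfl
  map_smul' _ _ := rfl

/-- The divergence of an element of `H(div; Ω)`, as a linear map. -/
def divₗ (Ω : Set (Space d)) : Hdiv Ω →ₗ[ℝ] L2 Ω where
  toFun := Hdiv.div
  map_add' _ _ := rfl
  map_smul' _ _ := rfl

theorem norm_field_le (v : Hdiv Ω) : ‖v.field‖ ≤ ‖v‖ := by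
  have := WithLp.prod_norm_sq_eq_of_L2 v.1
  refine (sq_le_sq₀ (norm_nonneg _) (norm_nonneg _)).1 ?_
  rw [Submodule.coe_norm, this]
  exact le_add_of_nonneg_right (sq_nonneg _)

theorem continuous_field : Continuous (Hdiv.field : Hdiv Ω → L2vec Ω) :=
  ((fieldₗ Ω).mkContinuous 1 fun v => by rw [one_mul]; exact norm_field_le v).continuous

end Spatial

/-! ### Stability of the mixed pressure problem. -/

/-- Stability of an abstract mixed problem with a coercive bounded operator. -/
theorem mixed_stability {X Y V : Type*} [NormedAddCommGroup X] [InnerProductSpace ℝ X]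
    [NormedAddCommGroup Y] [InnerProductSpace ℝ Y] [AddCommGroup V] [Module ℝ V]
    {φ : V →ₗ[ℝ] X} {δ : V →ₗ[ℝ] Y} {Cd al au : ℝ} (hCd : 0 ≤ Cd) (hal : 0 < al) (hau : 0 ≤ au)
    (hsurj : ∀ w, ∃ v, δ v = w ∧ ‖φ v‖ ≤ Cd * ‖w‖) {z G : X} {e : V} {r : Y}
    (hcoer : al * ‖φ e‖ ^ 2 ≤ ⟪z, φ e⟫_ℝ) (hbd : ‖z‖ ≤ au * ‖φ e‖)
    (heq : ∀ v, ⟪z, φ v⟫_ℝ - ⟪r, δ v⟫_ℝ = ⟪G, φ v⟫_ℝ) :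
    ‖φ e‖ ≤ ((Cd + (Cd * au + 1)) / al + 1) * (‖G‖ + ‖δ e‖) ∧
      ‖r‖ ≤ Cd * (au * ((Cd + (Cd * au + 1)) / al + 1) + 1) * (‖G‖ + ‖δ e‖) := by
  set m := ‖G‖ + ‖δ e‖ with hm
  have hG0 := norm_nonneg G
  have hδ0 := norm_nonneg (δ e)
  have hx0 := norm_nonneg (φ e)
  have hr0 := norm_nonneg r
  have hm0 : 0 ≤ m := by positivity
  -- The inf-sup argument: `r` is recovered by testing with a preimage of itself under `δ`.
  have hr : ‖r‖ ≤ Cd * (au * ‖φ e‖ + m) := by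
    obtain ⟨v, hv, hvn⟩ := hsurj r
    have h1 := heq v
    rw [hv, real_inner_self_eq_norm_sq] at h1
    have h2 := real_inner_le_norm z (φ v)
    have h3 := (abs_le.1 (abs_real_inner_le_norm G (φ v))).1
    have h4 : ‖r‖ * ‖r‖ ≤ ‖r‖ * (Cd * (au * ‖φ e‖ + m)) := by
      have h5 : (‖z‖ + ‖G‖) * ‖φ v‖ ≤ (au * ‖φ e‖ + m) * (Cd * ‖r‖) :=
        mul_le_mul (by linarith) hvn (norm_nonneg _) (by positivity)
      nlinarith
    rcases hr0.eq_or_lt with h0 | h0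
    · rw [← h0]; positivity
    · exact le_of_mul_le_mul_left h4 h0
  have hx : ‖φ e‖ ≤ ((Cd + (Cd * au + 1)) / al + 1) * m := by
    have hk : 0 ≤ (Cd + (Cd * au + 1)) / al := by positivity
    -- If `‖φ e‖` is at most `m` there is nothing to prove. Otherwise `m * m ≤ m * ‖φ e‖`, and one
    -- factor `‖φ e‖` cancels from the energy inequality.
    rcases le_total ‖φ e‖ m with hle | hle
    · nlinarith [mul_nonneg hk hm0]
    · have h1 := heq e
      have h2 := real_inner_le_norm G (φ e)
      have h3 := real_inner_le_norm r (δ e)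
      have h4 : ‖r‖ * ‖δ e‖ ≤ Cd * (au * ‖φ e‖ + m) * m :=
        mul_le_mul hr (by linarith) hδ0 (by positivity)
      have h5 : ‖G‖ * ‖φ e‖ ≤ m * ‖φ e‖ := by gcongr; linarith
      have h6 : Cd * m * m ≤ Cd * m * ‖φ e‖ := by gcongr
      have h7 : al * ‖φ e‖ ^ 2 ≤ (Cd + (Cd * au + 1)) * m * ‖φ e‖ := by linarith
      have h8 : ‖φ e‖ ≤ (Cd + (Cd * au + 1)) / al * m := by
        rcases hx0.eq_or_lt with h0 | h0
        · rw [← h0]; positivity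
        · rw [div_mul_eq_mul_div, le_div_iff₀ hal]
          refine le_of_mul_le_mul_right ?_ h0
          linarith
      linarith
  refine ⟨hx, hr.trans ?_⟩
  have := mul_le_mul_of_nonneg_left hx (mul_nonneg hCd hau)
  linarith

section Darcy

variable {d : ℕ} {Ω : Set (Space d)} {c : Coeffs d}

/-- `(p, u)` solves the mixed pressure problem for the saturation `s(θ)`. -/
structure IsDarcyPair (c : Coeffs d) (θ p : L2 Ω) (u : Hdiv Ω) : Prop where
  div_eq : u.div = c.f2Sat θ
  darcy : ∀ v : Hdiv Ω,
    ⟪c.aMul θ u.field, v.field⟫_ℝ - ⟪p, v.div⟫_ℝ + ⟪c.f3Sat θ, v.field⟫_ℝ = 0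

theorem IsContinuousSolution.isDarcyPair {T : ℝ} {ΘI : L2 Ω} {Θ : ℝ → L2 Ω} {q : ℝ → L2vec Ω}
    {p : ℝ → L2 Ω} {u : ℝ → Hdiv Ω} (h : IsContinuousSolution c Ω T ΘI Θ q p u) {t : ℝ}
    (ht : t ∈ Ioc 0 T) : IsDarcyPair c (Θ t) (p t) (u t) :=
  ⟨ext_inner_right ℝ (h.totalMass t ht), h.darcy t ht⟩

theorem IsSemiDiscreteStep.isDarcyPair {τ : ℝ} {θ' θ p : L2 Ω} {q u : Hdiv Ω}
    (h : IsSemiDiscreteStep c Ω τ θ' θ q p u) : IsDarcyPair c θ p u :=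
  ⟨ext_inner_right ℝ h.totalMass, h.darcy⟩

/-- Uniform bound for the velocity of the mixed pressure problem. -/
theorem Coeffs.Admissible.exists_velocity_bound (hc : c.Admissible) (hd : 1 ≤ d)
    (hΩb : Bornology.IsBounded Ω) :
    ∃ B : ℝ, ∀ (θ p : L2 Ω) (u : Hdiv Ω), IsDarcyPair c θ p u → ‖u.field‖ ≤ B := by
  obtain ⟨Cd, hCd, hsurj⟩ := exists_div_eq hd hΩb
  obtain ⟨al, au, hal, hab⟩ := hc.a_bounds
  have hau : 0 ≤ au := hal.le.trans ((hab 0).1.trans (hab 0).2)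
  obtain ⟨Ka, hKa⟩ := hc.a_lip
  obtain ⟨K2, hK2⟩ := hc.f2_lip
  obtain ⟨K3, hK3⟩ := hc.f3_lip
  obtain ⟨B2, hB2⟩ := hc.exists_norm_toL2_comp_le hΩb hK2.continuous
  obtain ⟨B3, hB3⟩ := hc.exists_norm_toL2_comp_le hΩb hK3.continuous
  refine ⟨((Cd + (Cd * au + 1)) / al + 1) * (B3 + B2), fun θ p u h => ?_⟩
  have hst := (mixed_stability (φ := fieldₗ Ω) (δ := divₗ Ω) (z := c.aMul θ u.field)
    (G := -c.f3Sat θ) (e := u) (r := p) hCd hal hau hsurj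
    (hc.le_inner_aMul (fun y => (hab y).1) θ u.field)
    (hc.norm_toL2_smul_le hKa.continuous
      (fun y => abs_le.2 ⟨by linarith [(hab y).1], (hab y).2⟩) θ u.field)
    (fun v => by
      have := h.darcy v
      change ⟪c.aMul θ u.field, v.field⟫_ℝ - ⟪p, v.div⟫_ℝ = ⟪-c.f3Sat θ, v.field⟫_ℝ
      rw [inner_neg_left]
      linarith)).1
  refine hst.trans (mul_le_mul_of_nonneg_left (add_le_add ?_ ?_) (by positivity))
  · rw [norm_neg]; exact hB3 θ
  · change ‖u.div‖ ≤ B2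
    rw [h.div_eq]
    exact hB2 θ

/-- Stability of the mixed pressure problem under changes of the saturation, for a bounded
velocity. -/
theorem Coeffs.Admissible.exists_darcy_lipschitz (hc : c.Admissible) (hd : 1 ≤ d)
    (hΩb : Bornology.IsBounded Ω) (M : ℝ) (hM : 0 ≤ M) :
    ∃ C : ℝ, 0 ≤ C ∧ ∀ (θ p : L2 Ω) (u : Hdiv Ω) (θ' p' : L2 Ω) (u' : Hdiv Ω),
      IsDarcyPair c θ p u → IsDarcyPair c θ' p' u' →
      (∀ᵐ x ∂((volume : Measure (Space d)).restrict Ω), ‖u.field x‖ ≤ M) →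
      ‖u.field - u'.field‖ ≤ C * ‖c.sat θ - c.sat θ'‖ ∧
        ‖p - p'‖ ≤ C * ‖c.sat θ - c.sat θ'‖ := by
  obtain ⟨Cd, hCd, hsurj⟩ := exists_div_eq hd hΩb
  obtain ⟨al, au, hal, hab⟩ := hc.a_bounds
  have hau : 0 ≤ au := hal.le.trans ((hab 0).1.trans (hab 0).2)
  obtain ⟨Ka, hKa⟩ := hc.a_lip
  obtain ⟨K2, hK2⟩ := hc.f2_lip
  obtain ⟨K3, hK3⟩ := hc.f3_lip
  set C₁ := (Cd + (Cd * au + 1)) / al + 1 with hC₁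
  set C₂ := Cd * (au * C₁ + 1) with hC₂
  have hC₁0 : 0 ≤ C₁ := by positivity
  have hC₂0 : 0 ≤ C₂ := by positivity
  refine ⟨(C₁ + C₂) * (Ka * M + K3 + K2), by positivity, fun θ p u θ' p' u' h h' hu => ?_⟩
  set σ := ‖c.sat θ - c.sat θ'‖ with hσ
  -- In the difference of the two Darcy laws the change of coefficient acts on the bounded velocity
  -- `u`, while the coercive operator with coefficient `a(s(θ'))` acts on `u - u'`. No bound on `u'`
  -- is needed.
  let G : L2vec Ω := -(c.aMul θ u.field - c.aMul θ' u.field) - (c.f3Sat θ - c.f3Sat θ')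
  have hst := mixed_stability (φ := fieldₗ Ω) (δ := divₗ Ω)
    (z := c.aMul θ' (u.field - u'.field)) (G := G) (e := u - u') (r := p - p') hCd hal hau hsurj
    (hc.le_inner_aMul (fun y => (hab y).1) θ' (u.field - u'.field))
    (hc.norm_toL2_smul_le hKa.continuous
      (fun y => abs_le.2 ⟨by linarith [(hab y).1], (hab y).2⟩) θ' (u.field - u'.field))
    (fun v => by
      have h1 := h.darcy v
      have h2 := h'.darcy v
      change ⟪c.aMul θ' (u.field - u'.field), v.field⟫_ℝ - ⟪p - p', v.div⟫_ℝ = ⟪G, v.field⟫_ℝ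
      rw [show c.aMul θ' (u.field - u'.field) = c.aMul θ' u.field - c.aMul θ' u'.field from
        hc.toL2_smul_sub hKa.continuous θ' u.field u'.field]
      simp only [G, inner_sub_left, inner_neg_left]
      linarith)
  have hG : ‖G‖ ≤ (Ka * M + K3) * σ := by
    refine (norm_sub_le _ _).trans ?_
    rw [norm_neg, add_mul]
    exact add_le_add (hc.norm_toL2_smul_sub_le hΩb hKa θ θ' hu)
      (hc.norm_toL2_comp_sub_le hΩb hK3 θ θ')
  have hdiv : ‖divₗ Ω (u - u')‖ ≤ K2 * σ := by
    change ‖u.div - u'.div‖ ≤ K2 * σ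
    rw [h.div_eq, h'.div_eq]
    exact hc.norm_toL2_comp_sub_le hΩb hK2 θ θ'
  have hsum : ‖G‖ + ‖divₗ Ω (u - u')‖ ≤ (Ka * M + K3 + K2) * σ := by linarith
  have hpos : 0 ≤ (Ka * M + K3 + K2) * σ := by positivity
  have h1 := mul_le_mul_of_nonneg_left hsum hC₁0
  have h2 := mul_le_mul_of_nonneg_left hsum hC₂0
  have h3 := mul_nonneg hC₁0 hpos
  have h4 := mul_nonneg hC₂0 hpos
  constructor
  · refine hst.1.trans ?_
    linarith
  · refine hst.2.trans ?_
    linarith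

/-! ### The lower order flux: bounds, Lipschitz estimate and measurability. -/

/-- The lower order flux `f_w(s(θ)) v + f₁(s(θ))`. -/
def Coeffs.lowerFlux (c : Coeffs d) (θ : L2 Ω) (v : L2vec Ω) : L2vec Ω :=
  c.fwMul θ v + c.f1Sat θ

theorem Coeffs.Admissible.exists_lowerFlux_bound (hc : c.Admissible) (hd : 1 ≤ d)
    (hΩb : Bornology.IsBounded Ω) :
    ∃ B : ℝ, ∀ (θ p : L2 Ω) (u : Hdiv Ω), IsDarcyPair c θ p u →
      ‖c.lowerFlux θ u.field‖ ≤ B := by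
  obtain ⟨Bu, hBu⟩ := hc.exists_velocity_bound hd hΩb
  obtain ⟨Kw, hKw⟩ := hc.fw_lip
  obtain ⟨Mw, hMw⟩ := hc.fw_bdd
  obtain ⟨K1, hK1⟩ := hc.f1_lip
  obtain ⟨B1, hB1⟩ := hc.exists_norm_toL2_comp_le hΩb hK1.continuous
  have hMw0 : 0 ≤ Mw := (abs_nonneg _).trans (hMw 0)
  refine ⟨Mw * Bu + B1, fun θ p u h => (norm_add_le _ _).trans (add_le_add ?_ (hB1 θ))⟩
  exact (hc.norm_toL2_smul_le hKw.continuous hMw θ u.field).trans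
    (mul_le_mul_of_nonneg_left (hBu θ p u h) hMw0)

/-- As in the Darcy problem, the change of `f_w` is paired with the bounded `v`, and the change of
velocity with the bounded function `f_w`. -/
theorem Coeffs.Admissible.exists_norm_lowerFlux_sub_le (hc : c.Admissible)
    (hΩb : Bornology.IsBounded Ω) (M : ℝ) (hM : 0 ≤ M) :
    ∃ C C' : ℝ, 0 ≤ C ∧ 0 ≤ C' ∧ ∀ (θ : L2 Ω) (v : L2vec Ω) (θ' : L2 Ω) (v' : L2vec Ω),
      (∀ᵐ x ∂((volume : Measure (Space d)).restrict Ω), ‖v x‖ ≤ M) →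
      ‖c.lowerFlux θ v - c.lowerFlux θ' v'‖
        ≤ C * ‖c.sat θ - c.sat θ'‖ + C' * ‖v - v'‖ := by
  obtain ⟨Kw, hKw⟩ := hc.fw_lip
  obtain ⟨Mw, hMw⟩ := hc.fw_bdd
  obtain ⟨K1, hK1⟩ := hc.f1_lip
  have hMw0 : 0 ≤ Mw := (abs_nonneg _).trans (hMw 0)
  refine ⟨Kw * M + K1, Mw, by positivity, hMw0, fun θ v θ' v' hv => ?_⟩
  have h1 : ‖c.fwMul θ v - c.fwMul θ' v‖ ≤ Kw * M * ‖c.sat θ - c.sat θ'‖ :=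
    hc.norm_toL2_smul_sub_le hΩb hKw θ θ' hv
  have h2 : ‖c.fwMul θ' (v - v')‖ ≤ Mw * ‖v - v'‖ :=
    hc.norm_toL2_smul_le hKw.continuous hMw θ' (v - v')
  have h3 : ‖c.f1Sat θ - c.f1Sat θ'‖ ≤ K1 * ‖c.sat θ - c.sat θ'‖ :=
    hc.norm_toL2_comp_sub_le hΩb hK1 θ θ'
  have h4 : c.fwMul θ' (v - v') = c.fwMul θ' v - c.fwMul θ' v' :=
    hc.toL2_smul_sub hKw.continuous θ' v v'
  have h5 : c.lowerFlux θ v - c.lowerFlux θ' v'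
      = (c.fwMul θ v - c.fwMul θ' v) + c.fwMul θ' (v - v') + (c.f1Sat θ - c.f1Sat θ') := by
    rw [h4, Coeffs.lowerFlux, Coeffs.lowerFlux]
    abel
  rw [h5]
  refine norm_add₃_le.trans ?_
  linarith

theorem Coeffs.Admissible.continuous_sat (hc : c.Admissible) (hΩb : Bornology.IsBounded Ω) :
    Continuous (c.sat : L2 Ω → L2 Ω) := by
  obtain ⟨_, _, _, hS⟩ := hc.exists_isSaturationMap hΩb
  exact hS.continuous

/-- The Lipschitz estimate is anchored at a bounded `v` and permits arbitrary neighbours. Continuity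
at such points suffices for measurability in time, since the continuous velocity is bounded at
almost every time. -/
theorem Coeffs.Admissible.continuousAt_lowerFlux (hc : c.Admissible)
    (hΩb : Bornology.IsBounded Ω) {M : ℝ} (hM : 0 ≤ M) (θ : L2 Ω) {v : L2vec Ω}
    (hv : ∀ᵐ x ∂((volume : Measure (Space d)).restrict Ω), ‖v x‖ ≤ M) :
    ContinuousAt (fun z : L2 Ω × L2vec Ω => c.lowerFlux z.1 z.2) (θ, v) := by
  obtain ⟨C, C', -, -, h⟩ := hc.exists_norm_lowerFlux_sub_le hΩb M hM
  rw [ContinuousAt, tendsto_iff_norm_sub_tendsto_zero]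
  have hlim : Tendsto (fun z : L2 Ω × L2vec Ω =>
      C * ‖c.sat θ - c.sat z.1‖ + C' * ‖v - z.2‖) (𝓝 (θ, v)) (𝓝 0) := by
    have hcont : Continuous fun z : L2 Ω × L2vec Ω =>
        C * ‖c.sat θ - c.sat z.1‖ + C' * ‖v - z.2‖ :=
      (continuous_const.mul (continuous_const.sub
        ((hc.continuous_sat hΩb).comp continuous_fst)).norm).add
        (continuous_const.mul (continuous_const.sub continuous_snd).norm)
    simpa using hcont.tendsto (θ, v)
  refine squeeze_zero (fun _ => norm_nonneg _) (fun z => ?_) hlim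
  rw [norm_sub_rev]
  exact h θ v z.1 z.2 hv

theorem Coeffs.Admissible.aestronglyMeasurable_lowerFlux (hc : c.Admissible)
    (hΩb : Bornology.IsBounded Ω) {M : ℝ} (hM : 0 ≤ M) {μ : Measure ℝ} {Θ : ℝ → L2 Ω}
    {v : ℝ → L2vec Ω} (hΘ : AEStronglyMeasurable Θ μ) (hv : AEStronglyMeasurable v μ)
    (hvM : ∀ᵐ t ∂μ, ∀ᵐ x ∂((volume : Measure (Space d)).restrict Ω), ‖v t x‖ ≤ M) :
    AEStronglyMeasurable (fun t => c.lowerFlux (Θ t) (v t)) μ :=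
  aestronglyMeasurable_comp_of_ae_continuousAt (f := fun t => (Θ t, v t))
    (g := fun z : L2 Ω × L2vec Ω => c.lowerFlux z.1 z.2) (hΘ.prodMk hv) <| by
    filter_upwards [hvM] with t ht
    exact hc.continuousAt_lowerFlux hΩb hM (Θ t) ht

theorem Coeffs.Admissible.aestronglyMeasurable_f1Sat (hc : c.Admissible)
    (hΩb : Bornology.IsBounded Ω) {μ : Measure ℝ} {Θ : ℝ → L2 Ω}
    (hΘ : AEStronglyMeasurable Θ μ) :
    AEStronglyMeasurable (fun t => c.f1Sat (Θ t)) μ := by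
  obtain ⟨K1, hK1⟩ := hc.f1_lip
  refine Continuous.comp_aestronglyMeasurable (g := fun θ : L2 Ω => c.f1Sat θ) ?_ hΘ
  rw [continuous_iff_continuousAt]
  intro θ
  rw [ContinuousAt, tendsto_iff_norm_sub_tendsto_zero]
  have hlim : Tendsto (fun z => K1 * ‖c.sat z - c.sat θ‖) (𝓝 θ) (𝓝 0) := by
    have hcont : Continuous fun z => K1 * ‖c.sat z - c.sat θ‖ :=
      continuous_const.mul ((hc.continuous_sat hΩb).sub continuous_const).norm
    simpa using hcont.tendsto θ
  exact squeeze_zero (fun _ => norm_nonneg _)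
    (fun z => hc.norm_toL2_comp_sub_le hΩb hK1 z θ) hlim

end Darcy

/-! ### Time means. -/

/-- The error of a time mean is controlled by the pointwise error. -/
theorem mul_norm_timeMean_sub_sq_le {X : Type*} [NormedAddCommGroup X] [InnerProductSpace ℝ X]
    [CompleteSpace X] {T τ C : ℝ} {N n : ℕ} (hτ : 0 < τ) (hNτ : N * τ = T)
    (hn : n ∈ Finset.Icc 1 N) {g : ℝ → X} (hg : MemLp g 2 (volume.restrict (Ioc 0 T))) (x : X)
    {σ : ℝ → ℝ} (hσ : IntegrableOn (fun t => σ t ^ 2) (Ioc 0 T))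
    (hgσ : ∀ᵐ t ∂(volume.restrict (Ioc 0 T)), ‖g t - x‖ ≤ C * σ t) :
    τ * ‖timeMean τ g n - x‖ ^ 2
      ≤ C ^ 2 * ∫ t in timePoint τ (n - 1)..timePoint τ n, σ t ^ 2 := by
  rw [Finset.mem_Icc] at hn
  have hle : timePoint τ (n - 1) ≤ timePoint τ n := timePoint_mono hτ.le (Nat.sub_le n 1)
  have h0 := timePoint_nonneg hτ.le (n - 1)
  have hnT := timePoint_le hτ.le hNτ hn.2
  have hgm : MemLp (fun t => g t - x) 2 (volume.restrict (Ioc 0 T)) := hg.sub (memLp_const _)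
  have hgi := intervalIntegrable_of_integrableOn_Ioc (hg.integrable (by norm_num)) h0
    (hle.trans hnT) (h0.trans hle) hnT
  have hg2 := intervalIntegrable_of_integrableOn_Ioc (integrable_norm_sq_of_memLp_two hgm) h0
    (hle.trans hnT) (h0.trans hle) hnT
  have hσi := intervalIntegrable_of_integrableOn_Ioc hσ h0 (hle.trans hnT) (h0.trans hle) hnT
  have hmean : timeMean τ g n - x
      = τ⁻¹ • ∫ t in timePoint τ (n - 1)..timePoint τ n, (g t - x) := by
    rw [intervalIntegral.integral_sub hgi intervalIntegrable_const,
      intervalIntegral.integral_const, timePoint_sub_pred τ hn.1, smul_sub, smul_smul,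
      inv_mul_cancel₀ hτ.ne', one_smul, timeMean]
  have hj := norm_sq_intervalIntegral_le hle (hgi.sub intervalIntegrable_const) hg2
  rw [timePoint_sub_pred τ hn.1] at hj
  have hmono : ∫ t in timePoint τ (n - 1)..timePoint τ n, ‖g t - x‖ ^ 2
      ≤ C ^ 2 * ∫ t in timePoint τ (n - 1)..timePoint τ n, σ t ^ 2 := by
    rw [← intervalIntegral.integral_const_mul, intervalIntegral.integral_of_le hle,
      intervalIntegral.integral_of_le hle]
    refine integral_mono_ae hg2.1 (hσi.const_mul _).1 ?_
    filter_upwards [ae_restrict_of_ae_restrict_of_subset (Ioc_subset_Ioc h0 hnT) hgσ] with t ht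
    have := pow_le_pow_left₀ (norm_nonneg _) ht 2
    rwa [mul_pow] at this
  refine le_trans ?_ hmono
  rw [hmean, norm_smul, mul_pow, norm_inv, Real.norm_of_nonneg hτ.le]
  calc τ * (τ⁻¹ ^ 2 * ‖∫ t in timePoint τ (n - 1)..timePoint τ n, (g t - x)‖ ^ 2)
      ≤ τ * (τ⁻¹ ^ 2 * (τ * ∫ t in timePoint τ (n - 1)..timePoint τ n, ‖g t - x‖ ^ 2)) := by
        gcongr
    _ = _ := by field_simp

theorem volume_restrict_Ioo_eq_Ioc (T : ℝ) :
    (volume : Measure ℝ).restrict (Ioo 0 T) = volume.restrict (Ioc 0 T) :=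
  Measure.restrict_congr_set Ioo_ae_eq_Ioc

/-! ### The two-phase flow problems as abstract flows. -/

section Main

variable {d : ℕ} {Ω : Set (Space d)} {c : Coeffs d} {T : ℝ} {ΘI : L2 Ω}

theorem IsContinuousSolution.exists_isFlow (hc : c.Admissible) (hΩb : Bornology.IsBounded Ω)
    {Θ : ℝ → L2 Ω} {q : ℝ → L2vec Ω} {p : ℝ → L2 Ω} {u : ℝ → Hdiv Ω}
    (h : IsContinuousSolution c Ω T ΘI Θ q p u) {M : ℝ} (hM : 0 ≤ M)
    (hu : ∀ᵐ t ∂(volume.restrict (Ioc 0 T)),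
      ∀ᵐ x ∂((volume : Measure (Space d)).restrict Ω), ‖(u t).field x‖ ≤ M) {Bf : ℝ}
    (hBf : ∀ (θ p : L2 Ω) (u : Hdiv Ω), IsDarcyPair c θ p u → ‖c.lowerFlux θ u.field‖ ≤ Bf) :
    ∃ Q : ℝ → Hdiv Ω, IsFlow (fieldₗ Ω) (divₗ Ω) c.sat T ΘI Bf Θ q
      (fun t => c.lowerFlux (Θ t) (u t).field) Q := by
  obtain ⟨Q, -, hQ, hmass⟩ := h.mass
  have hΘm : MemLp Θ 2 (volume.restrict (Ioc 0 T)) := volume_restrict_Ioo_eq_Ioc T ▸ h.Θ_mem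
  have hqm : MemLp q 2 (volume.restrict (Ioc 0 T)) := volume_restrict_Ioo_eq_Ioc T ▸ h.q_mem
  have hum : MemLp u 2 (volume.restrict (Ioc 0 T)) := volume_restrict_Ioo_eq_Ioc T ▸ h.u_mem
  have hufm : AEStronglyMeasurable (fun t => (u t).field) (volume.restrict (Ioc 0 T)) :=
    continuous_field.comp_aestronglyMeasurable hum.1
  have hFm := hc.aestronglyMeasurable_lowerFlux hΩb hM hΘm.1 hufm hu
  have hFb : ∀ᵐ t ∂(volume.restrict (Ioc 0 T)), ‖c.lowerFlux (Θ t) (u t).field‖ ≤ Bf := by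
    filter_upwards [ae_restrict_mem measurableSet_Ioc] with t ht
    exact hBf _ _ _ (h.isDarcyPair ht)
  refine ⟨Q, hΘm, hqm, hFm, hFb, fun t ht => hQ t (Ioc_subset_Icc_self ht), fun t ht => ?_,
    fun t ht v => ?_⟩
  · refine ext_inner_right ℝ fun w => ?_
    rw [inner_add_left, inner_zero_left]
    exact hmass t ht w
  · have h1 := h.flux t ht v
    obtain ⟨K1, hK1⟩ := hc.f1_lip
    obtain ⟨B1, hB1⟩ := hc.exists_norm_toL2_comp_le hΩb hK1.continuous
    have hf1 : IntegrableOn (fun t => c.f1Sat (Θ t)) (Ioc 0 T) :=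
      Integrable.of_bound (hc.aestronglyMeasurable_f1Sat hΩb hΘm.1) B1
        (Eventually.of_forall fun t => hB1 (Θ t))
    have hFi : IntegrableOn (fun t => c.lowerFlux (Θ t) (u t).field) (Ioc 0 T) :=
      Integrable.of_bound hFm Bf hFb
    have hT : 0 ≤ T := ht.1.le.trans ht.2
    have hf1i := intervalIntegrable_of_integrableOn_Ioc hf1 le_rfl hT ht.1.le ht.2
    have hFii := intervalIntegrable_of_integrableOn_Ioc hFi le_rfl hT ht.1.le ht.2
    -- The `f_w` term is recovered as a difference of two functions already known to be integrable
    -- in time.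
    have hsplit : ∫ y in (0 : ℝ)..t, c.fwMul (Θ y) (u y).field
        = (∫ y in (0 : ℝ)..t, c.lowerFlux (Θ y) (u y).field)
          - ∫ y in (0 : ℝ)..t, c.f1Sat (Θ y) := by
      rw [← intervalIntegral.integral_sub hFii hf1i]
      simp [Coeffs.lowerFlux]
    rw [hsplit, inner_sub_left] at h1
    change ⟪_, v.field⟫_ℝ - ⟪_, v.div⟫_ℝ = ⟪_, v.field⟫_ℝ
    linarith

theorem IsSemiDiscreteSolution.isEulerFlow {τ : ℝ} {N : ℕ} {Θn : ℕ → L2 Ω} {qn : ℕ → Hdiv Ω}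
    {pn : ℕ → L2 Ω} {un : ℕ → Hdiv Ω}
    (h : IsSemiDiscreteSolution c Ω τ N ΘI Θn qn pn un) {Bf : ℝ}
    (hBf : ∀ (θ p : L2 Ω) (u : Hdiv Ω), IsDarcyPair c θ p u → ‖c.lowerFlux θ u.field‖ ≤ Bf) :
    IsEulerFlow (fieldₗ Ω) (divₗ Ω) c.sat τ N ΘI Bf Θn qn
      (fun n => c.lowerFlux (Θn n) (un n).field) := by
  refine ⟨h.1, fun n hn => hBf _ _ _ (h.2 n hn).isDarcyPair, fun n hn => ?_, fun n hn v => ?_⟩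
  · refine ext_inner_right ℝ fun w => ?_
    rw [inner_add_left, inner_zero_left, real_inner_smul_left]
    exact (h.2 n hn).mass w
  · have h1 := (h.2 n hn).flux v
    change ⟪(qn n).field, v.field⟫_ℝ - ⟪Θn n, v.div⟫_ℝ = ⟪c.lowerFlux (Θn n) (un n).field, v.field⟫_ℝ
    rw [Coeffs.lowerFlux, inner_add_left]
    linarith

end Main

end TwoPhase

end

/-! ### The error estimates. -/

theorem mainTheorem6 {d : ℕ} (hd : 1 ≤ d) (Ω : Set (TwoPhase.Space d)) (hΩ : IsOpen Ω)
    (hΩb : Bornology.IsBounded Ω) (T : ℝ) (hT : 0 < T) (c : TwoPhase.Coeffs d)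
    (hc : c.Admissible) (ΘI : TwoPhase.L2 Ω) (Mu : ℝ) :
    ∃ C τ₀ : ℝ, 0 < C ∧ 0 < τ₀ ∧
      ∀ (Θ : ℝ → TwoPhase.L2 Ω) (q : ℝ → TwoPhase.L2vec Ω) (p : ℝ → TwoPhase.L2 Ω)
        (u : ℝ → TwoPhase.Hdiv Ω),
        TwoPhase.IsContinuousSolution c Ω T ΘI Θ q p u →
        (∀ᵐ t ∂((volume : Measure ℝ).restrict (Ioo 0 T)),
          ∀ᵐ x ∂((volume : Measure (TwoPhase.Space d)).restrict Ω), ‖(u t).field x‖ ≤ Mu) →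
      ∀ (N : ℕ) (τ : ℝ), 1 ≤ N → τ = T / N → τ ≤ τ₀ →
      ∀ (Θn : ℕ → TwoPhase.L2 Ω) (qn : ℕ → TwoPhase.Hdiv Ω) (pn : ℕ → TwoPhase.L2 Ω)
        (un : ℕ → TwoPhase.Hdiv Ω),
        TwoPhase.IsSemiDiscreteSolution c Ω τ N ΘI Θn qn pn un →
        ((∑ n ∈ Finset.Icc 1 N, ∫ t in TwoPhase.timePoint τ (n - 1)..TwoPhase.timePoint τ n,
              ⟪c.sat (Θ t) - c.sat (Θn n), Θ t - Θn n⟫_ℝ)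
            + ‖∑ n ∈ Finset.Icc 1 N, ∫ t in TwoPhase.timePoint τ (n - 1)..TwoPhase.timePoint τ n,
                (q t - (qn n).field)‖ ^ 2
            + ∑ n ∈ Finset.Icc 1 N,
                ‖∫ t in TwoPhase.timePoint τ (n - 1)..TwoPhase.timePoint τ n,
                  (q t - (qn n).field)‖ ^ 2
          ≤ C * τ) ∧
        (∀ n ∈ Finset.Icc 1 N,
          τ * ‖TwoPhase.timeMean τ (fun t => (u t).field) n - (un n).field‖ ^ 2
              + τ * ‖TwoPhase.timeMean τ p n - pn n‖ ^ 2
            ≤ C * ∫ t in TwoPhase.timePoint τ (n - 1)..TwoPhase.timePoint τ n,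
                ‖c.sat (Θ t) - c.sat (Θn n)‖ ^ 2) ∧
        ‖∑ n ∈ Finset.Icc 1 N, ∫ t in TwoPhase.timePoint τ (n - 1)..TwoPhase.timePoint τ n,
            (Θ t - Θn n)‖ ^ 2 ≤ C * τ := by
  obtain ⟨Cd, hCd, hsurj⟩ := TwoPhase.exists_div_eq hd hΩb
  obtain ⟨Φ, L, B, hS⟩ := hc.exists_isSaturationMap hΩb
  obtain ⟨Bf, hBf⟩ := hc.exists_lowerFlux_bound hd hΩb
  obtain ⟨Cu, hCu, hdarcy⟩ := hc.exists_darcy_lipschitz hd hΩb |Mu| (abs_nonneg _)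
  obtain ⟨C₁, C₂, hC₁, hC₂, hlow⟩ := hc.exists_norm_lowerFlux_sub_le hΩb |Mu| (abs_nonneg _)
  have hL := hS.L_pos
  -- The flux depends on the saturation directly, with constant `C₁`, and through the velocity, with
  -- constant `C₂ * Cu`.
  set K := C₁ + C₂ * Cu with hK
  set A := (18 * TwoPhase.energy c.sat Φ ΘI + 17 * (Bf ^ 2 * T))
    * (1 + K ^ 2 * L * T * Real.exp (2 * (K ^ 2 * L * T))) with hA
  have hA0 : 0 ≤ A := by
    have := hS.energy_nonneg ΘI
    positivity
  set A' := 2 * Cd ^ 2 * ((1 + T * (K ^ 2 * L)) * A) with hA'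
  have hA'0 : 0 ≤ A' := by positivity
  have hCu2 := sq_nonneg Cu
  -- `A` serves the first estimate and `A'` the last; the velocity and the pressure each contribute
  -- one `Cu ^ 2`. The choice of `τ₀` gives `K ^ 2 * L * τ ≤ 1 / 2`, as the Grönwall inequality
  -- requires.
  refine ⟨A + A' + 2 * Cu ^ 2 + 1, 1 / (2 * (K ^ 2 * L + 1)), by positivity, by positivity,
    fun Θ q p u h hu N τ hN hτN hτ Θn qn pn un hn => ?_⟩
  have hN0 : (0 : ℝ) < N := by exact_mod_cast hN
  have hτ0 : 0 < τ := hτN ▸ div_pos hT hN0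
  have hNτ : N * τ = T := by rw [hτN]; field_simp
  have hsmall : K ^ 2 * L * τ ≤ 1 / 2 := by
    rw [le_div_iff₀ (by positivity)] at hτ
    linarith
  rw [TwoPhase.volume_restrict_Ioo_eq_Ioc] at hu
  have hu' : ∀ᵐ t ∂((volume : Measure ℝ).restrict (Ioc 0 T)),
      ∀ᵐ x ∂((volume : Measure (TwoPhase.Space d)).restrict Ω), ‖(u t).field x‖ ≤ |Mu| := by
    filter_upwards [hu] with t ht
    filter_upwards [ht] with x hx
    exact hx.trans (le_abs_self Mu)
  obtain ⟨Q, hflow⟩ := h.exists_isFlow hc hΩb (abs_nonneg Mu) hu' hBf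
  have heuler := hn.isEulerFlow hBf
  have hpt : ∀ n ∈ Finset.Icc 1 N, ∀ᵐ t ∂((volume : Measure ℝ).restrict (Ioc 0 T)),
      ‖(u t).field - (un n).field‖ ≤ Cu * ‖c.sat (Θ t) - c.sat (Θn n)‖ ∧
        ‖p t - pn n‖ ≤ Cu * ‖c.sat (Θ t) - c.sat (Θn n)‖ := by
    intro n hnN
    filter_upwards [hu', ae_restrict_mem measurableSet_Ioc] with t ht htm
    exact hdarcy _ _ _ _ _ _ (h.isDarcyPair htm) (hn.2 n hnN).isDarcyPair ht
  have hFK : ∀ n ∈ Finset.Icc 1 N, ∀ᵐ t ∂((volume : Measure ℝ).restrict (Ioc 0 T)),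
      ‖c.lowerFlux (Θ t) (u t).field - c.lowerFlux (Θn n) (un n).field‖
        ≤ K * ‖c.sat (Θ t) - c.sat (Θn n)‖ := by
    intro n hnN
    filter_upwards [hpt n hnN, hu'] with t ht htu
    have h1 := hlow (Θ t) (u t).field (Θn n) (un n).field htu
    have h2 := mul_le_mul_of_nonneg_left ht.1 hC₂
    rw [hK]
    linarith
  have hfirst := hflow.error_le hT hS hτ0 hNτ hsmall heuler hFK
  have hthird := hflow.error_potential_le hS hsurj hτ0 hNτ heuler hFK
  have hle : ∀ n, TwoPhase.timePoint τ (n - 1) ≤ TwoPhase.timePoint τ n := fun n =>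
    TwoPhase.timePoint_mono hτ0.le (Nat.sub_le n 1)
  rw [mul_assoc, ← hA] at hfirst
  have hAτ : τ * A ≤ (A + A' + 2 * Cu ^ 2 + 1) * τ := by
    rw [mul_comm]
    exact mul_le_mul_of_nonneg_right (by linarith) hτ0.le
  refine ⟨hfirst.trans hAτ, fun n hnN => ?_, ?_⟩
  · have hσ := hflow.integrable_saturation_sub_norm_sq hS (Θn n)
    have hum : MemLp u 2 (volume.restrict (Ioc 0 T)) :=
      TwoPhase.volume_restrict_Ioo_eq_Ioc T ▸ h.u_mem
    have hpm : MemLp p 2 (volume.restrict (Ioc 0 T)) :=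
      TwoPhase.volume_restrict_Ioo_eq_Ioc T ▸ h.p_mem
    have hufm : MemLp (fun t => (u t).field) 2 (volume.restrict (Ioc 0 T)) :=
      hum.of_le (TwoPhase.continuous_field.comp_aestronglyMeasurable hum.1)
        (Filter.Eventually.of_forall fun t => TwoPhase.norm_field_le (u t))
    have h1 := TwoPhase.mul_norm_timeMean_sub_sq_le hτ0 hNτ hnN hufm (un n).field hσ
      ((hpt n hnN).mono fun t ht => ht.1)
    have h2 := TwoPhase.mul_norm_timeMean_sub_sq_le hτ0 hNτ hnN hpm (pn n) hσ
      ((hpt n hnN).mono fun t ht => ht.2)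
    have h3 : 0 ≤ ∫ t in TwoPhase.timePoint τ (n - 1)..TwoPhase.timePoint τ n,
        ‖c.sat (Θ t) - c.sat (Θn n)‖ ^ 2 :=
      intervalIntegral.integral_nonneg (hle n) fun t _ => sq_nonneg _
    refine (add_le_add h1 h2).trans ?_
    rw [← add_mul]
    exact mul_le_mul_of_nonneg_right (by linarith) h3
  · have hP : 0 ≤ ∑ n ∈ Finset.Icc 1 N,
        ∫ t in TwoPhase.timePoint τ (n - 1)..TwoPhase.timePoint τ n,
          ⟪c.sat (Θ t) - c.sat (Θn n), Θ t - Θn n⟫_ℝ :=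
      Finset.sum_nonneg fun n _ => intervalIntegral.integral_nonneg (hle n) fun t _ =>
        nonneg_of_mul_nonneg_right ((sq_nonneg _).trans (hS.cocoercive (Θ t) (Θn n))) hL
    have hD : 0 ≤ ∑ n ∈ Finset.Icc 1 N,
        ‖∫ t in TwoPhase.timePoint τ (n - 1)..TwoPhase.timePoint τ n,
          (q t - TwoPhase.fieldₗ Ω (qn n))‖ ^ 2 := Finset.sum_nonneg fun n _ => sq_nonneg _
    set E := ‖∑ n ∈ Finset.Icc 1 N,
      ∫ t in TwoPhase.timePoint τ (n - 1)..TwoPhase.timePoint τ n,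
        (q t - TwoPhase.fieldₗ Ω (qn n))‖ ^ 2 with hE
    have hE0 : 0 ≤ E := sq_nonneg _
    have hEle : E ≤ τ * A := by linarith
    have hPle := mul_le_mul_of_nonneg_left
      (show (∑ n ∈ Finset.Icc 1 N,
        ∫ t in TwoPhase.timePoint τ (n - 1)..TwoPhase.timePoint τ n,
          ⟪c.sat (Θ t) - c.sat (Θn n), Θ t - Θn n⟫_ℝ) ≤ τ * A by linarith)
      (show 0 ≤ T * (K ^ 2 * L) by positivity)
    refine hthird.trans ((mul_le_mul_of_nonneg_left (add_le_add hEle hPle)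
      (by positivity)).trans ?_)
    have : 2 * Cd ^ 2 * (τ * A + T * (K ^ 2 * L) * (τ * A)) = A' * τ := by rw [hA']; ring
    rw [this]
    exact mul_le_mul_of_nonneg_right (by linarith) hτ0.le
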